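/- **Theorem 4.1.** Let $0<d<1/2$, $d_1=d$, $d_2=1-d$, let $a_1>0$, $a_2,h_1,\tilde h_1,h_2\in\mathbb R$, and let $q_1,\tilde q_1\in L_2(0,d_1)$ and $q_2\in L_2(0,d_2)$ be real-valued. Let $L=L(d,q_1,q_2,h_1,h_2,a_1,a_2)$ denote the boundary value problem $$-y_j''+q_j(x)y_j=\lambda^2y_j,\quad x\in(0,d_j),\qquad y_j'(0)-h_jy_j(0)=0,\qquad j=1,2,$$ $$y_2(d_2)=a_1y_1(d_1),\qquad y_2'(d_2)+a_1^{-1}y_1'(d_1)+a_2y_1(d_1)=0,$$ and let $\tilde L=L(d,\tilde q_1,q_2,\tilde h_1,h_2,a_1,a_2)$ be the problem with $q_1,h_1$ replaced by $\tilde q_1,\tilde h_1$. Let $\lambda_0^2<\lambda_1^2<\cdots$ and $\tilde\lambda_0^2<\tilde\lambda_1^2<\cdots$ be all the eigenvalues (they are real) of $L$ and of $\tilde L$, respectively; here $\lambda_n,\tilde\lambda_n\in\mathbb C$ are any fixed square roots of the eigenvalues (for instance the positive ones, if all the eigenvalues are positive). Put $$\omega_1=h_1+\tfrac12\int_0^dq_1(x)\,dx,\qquad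 \tilde\omega_1=\tilde h_1+\tfrac12\int_0^d\tilde q_1(x)\,dx.$$ Let $I\subseteq\mathbb N\cup\{0\}$. Suppose that $\lambda_n=\tilde\lambda_n$ for all $n\in I$, that $\omega_1=\tilde\omega_1$, and that the system $\{\exp(\pm i\lambda_nx)\}_{n\in I}$ is complete in $L_2(-2d,2d)$, i.e. its complex linear span is dense in the complex space $L_2(-2d,2d)$. Then $q_1=\tilde q_1$ almost everywhere on $(0,d)$, and $h_1=\tilde h_1$. -/

import Mathlib

open MeasureTheory Set

namespace DiscontinuousSL

/-- `y` is a solution on `[0, b]` of `-y'' + q y = z y` with derivative `y' = p`, where `q` is real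
and integrable on `(0, b)` (in the application `q` is square integrable). As usual for such `q`, a
solution is a continuously differentiable function whose derivative is absolutely continuous with
`y'' = (q - z) y` almost everywhere; since `(q - z) y` is integrable on `(0, b)`, the latter says
exactly that `y'(x) = y'(0) + ∫₀ˣ (q - z) y`. -/
structure IsSolution (b : ℝ) (q : ℝ → ℝ) (z : ℂ) (y p : ℝ → ℂ) : Prop where
  hasDeriv : ∀ x ∈ Icc 0 b, HasDerivWithinAt y (p x) (Icc 0 b) x
  deriv_eq : ∀ x ∈ Icc 0 b, p x = p 0 + ∫ t in (0 : ℝ)..x, ((q t : ℂ) - z) * y t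

/-- `z` is an eigenvalue of the problem `L(d, q₁, q₂, h₁, h₂, a₁, a₂)`: with `d₁ = d`, `d₂ = 1 - d`
there are `y₁`, `y₂` (with derivatives `p₁`, `p₂`), not both identically zero, such that
`-yⱼ'' + qⱼ yⱼ = z yⱼ` on `(0, dⱼ)`, `yⱼ'(0) - hⱼ yⱼ(0) = 0`, `y₂(d₂) = a₁ y₁(d₁)` and
`y₂'(d₂) + a₁⁻¹ y₁'(d₁) + a₂ y₁(d₁) = 0`. -/
def IsEigenvalue (d : ℝ) (q₁ q₂ : ℝ → ℝ) (h₁ h₂ a₁ a₂ : ℝ) (z : ℂ) : Prop :=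
  ∃ y₁ p₁ y₂ p₂ : ℝ → ℂ,
    IsSolution d q₁ z y₁ p₁ ∧ IsSolution (1 - d) q₂ z y₂ p₂ ∧
    p₁ 0 - (h₁ : ℂ) * y₁ 0 = 0 ∧ p₂ 0 - (h₂ : ℂ) * y₂ 0 = 0 ∧
    y₂ (1 - d) = (a₁ : ℂ) * y₁ d ∧
    p₂ (1 - d) + (a₁ : ℂ)⁻¹ * p₁ d + (a₂ : ℂ) * y₁ d = 0 ∧
    ((∃ x ∈ Icc 0 d, y₁ x ≠ 0) ∨ (∃ x ∈ Icc 0 (1 - d), y₂ x ≠ 0))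

/-- `(lam n)²`, `n ≥ 0`, is the strictly increasing sequence of all the eigenvalues of the problem
`L(d, q₁, q₂, h₁, h₂, a₁, a₂)`. The eigenvalues are real; `lam n` is any of the square roots,
so it is purely imaginary if the eigenvalue is negative. -/
def IsSpectrum (d : ℝ) (q₁ q₂ : ℝ → ℝ) (h₁ h₂ a₁ a₂ : ℝ) (lam : ℕ → ℂ) : Prop :=
  ∃ E : ℕ → ℝ, StrictMono E ∧ (∀ n, lam n ^ 2 = (E n : ℂ)) ∧
    {z : ℂ | IsEigenvalue d q₁ q₂ h₁ h₂ a₁ a₂ z} = range (fun n => (E n : ℂ))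

/-- `ω = h + ½ ∫₀ᵇ q`. -/
noncomputable def omega (b : ℝ) (q : ℝ → ℝ) (h : ℝ) : ℝ :=
  h + (1 / 2) * ∫ x in (0 : ℝ)..b, q x

/-- Lebesgue measure on `(-c, c)`. -/
noncomputable abbrev symMeasure (c : ℝ) : Measure ℝ := volume.restrict (Ioo (-c) c)

theorem memLp_exp (c : ℝ) (m : ℂ) :
    MemLp (fun x : ℝ => Complex.exp (Complex.I * m * (x : ℂ))) 2 (symMeasure c) := by
  have hc : Continuous (fun x : ℝ => Complex.exp (Complex.I * m * (x : ℂ))) := by fun_prop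
  obtain ⟨C, hC⟩ := (isCompact_Icc (a := -c) (b := c)).exists_bound_of_continuousOn hc.continuousOn
  refine MemLp.of_bound hc.aestronglyMeasurable C ?_
  filter_upwards [ae_restrict_mem measurableSet_Ioo] with x hx
  exact hC x (Ioo_subset_Icc_self hx)

/-- The function `x ↦ exp (i m x)` as an element of the complex space `L₂(-c, c)`. -/
noncomputable def expL2 (c : ℝ) (m : ℂ) : Lp ℂ 2 (symMeasure c) := (memLp_exp c m).toLp _

/-- The system `{exp (± i lam n x)}`, `n ∈ I`, is complete in the complex space `L₂(-c, c)`: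
its linear span is dense. -/
def ExpSystemComplete (c : ℝ) (I : Set ℕ) (lam : ℕ → ℂ) : Prop :=
  (Submodule.span ℂ
    {f : Lp ℂ 2 (symMeasure c) |
      ∃ n ∈ I, f = expL2 c (lam n) ∨ f = expL2 c (-lam n)}).topologicalClosure = ⊤

end DiscontinuousSL

namespace DiscontinuousSL

/-! The second edge and the matching conditions are shared by both problems. At a common eigenvalue
`l ^ 2` the Lagrange identity on that edge makes the Wronskian of the two second components vanish
at the junction, and matching carries this over to the first components. The Lagrange identity on
the first edge, after division by the nonzero values of the first components at `0`, then gives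
`(h₁' - h₁) + ∫ (q₁' - q₁) φ φ' = 0`, where `φ`, `φ'` are the normalized solutions on the first edge
(`common_eigenvalue_identity`).

A transformation operator writes `φ(x) = cos (l x) + ∫ k(x, v) exp (i l v) dv`, with `k` independent
of `l` and supported in the cone `|v| < x`. The kernel comes from the Volterra equation for `φ`
after reading each factor `sin (l r) / l` as half the Fourier integral of a box of half-width `r`.
This gives an `l`-free integral equation, solved by iteration (`Potential.exists_weighted_kernel`,
`Potential.phi_eq_volterra`, `IsSolution.eq_mul_phi`). Hence `φ φ'` at `x` equals `1/2 + cos (2 l x)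
/ 2` plus the Fourier integral of a kernel supported in `|v| < 2 x`
(`ConeKernel.transform_prodKernel`).

Equality of `ω₁` and `ω̃₁` cancels `h₁' - h₁` against the `1/2` term. What remains says that one
square integrable function on `(-2d, 2d)`, the `density`, is orthogonal to `exp (± i lam n v)` for
every `n ∈ I`. By completeness it vanishes. On `(0, 2d)` this is a homogeneous Volterra equation for
the rescaled difference of the potentials, which is therefore zero; equality of `ω₁` and `ω̃₁` then
gives `h₁ = h₁'`. -/

/-! ### Integration by parts for primitives of integrable functions. -/

/-- Fubini: the square `(0, b]²` splits into the triangles `t ≤ s` and `s < t`, and each of the two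
terms integrates `f ⊗ g` over one of them. -/
theorem integral_mul_integral_eq_add {f g : ℝ → ℂ} {b : ℝ} (hb : 0 ≤ b)
    (hf : IntervalIntegrable f volume 0 b) (hg : IntervalIntegrable g volume 0 b) :
    (∫ s in (0 : ℝ)..b, f s) * ∫ t in (0 : ℝ)..b, g t =
      ∫ s in (0 : ℝ)..b, (f s * (∫ t in (0 : ℝ)..s, g t) + (∫ t in (0 : ℝ)..s, f t) * g s) := by
  rw [intervalIntegral.integral_add
    (hf.mul_continuousOn (intervalIntegral.continuousOn_primitive_interval' hg left_mem_uIcc))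
    (hg.continuousOn_mul (intervalIntegral.continuousOn_primitive_interval' hf left_mem_uIcc))]
  simp only [intervalIntegral.integral_of_le hb]
  set μ := volume.restrict (Ioc 0 b) with hμ
  have hfg : Integrable (fun z : ℝ × ℝ => f z.1 * g z.2) (μ.prod μ) := hf.1.mul_prod hg.1
  have hA : MeasurableSet {z : ℝ × ℝ | z.2 ≤ z.1} := measurableSet_le measurable_snd measurable_fst
  rw [← integral_prod_mul, ← integral_add_compl hA hfg, ← integral_indicator hA,
    ← integral_indicator hA.compl, integral_prod _ (hfg.indicator hA),
    integral_prod_symm _ (hfg.indicator hA.compl)]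
  congr 1
  · refine setIntegral_congr_fun measurableSet_Ioc fun s hs => ?_
    have : ∀ t, indicator {z : ℝ × ℝ | z.2 ≤ z.1} (fun z : ℝ × ℝ => f z.1 * g z.2) (s, t)
        = f s * indicator (Iic s) g t := by
      intro t
      by_cases h : t ≤ s <;> simp [h]
    simp only [this]
    rw [integral_const_mul, integral_indicator measurableSet_Iic, hμ,
      Measure.restrict_restrict measurableSet_Iic, intervalIntegral.integral_of_le hs.1.le]
    congr 3
    ext t; simp only [mem_inter_iff, mem_Iic, mem_Ioc]
    exact ⟨fun h => ⟨h.2.1, h.1⟩, fun h => ⟨h.2, h.1, h.2.trans hs.2⟩⟩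
  · refine setIntegral_congr_fun measurableSet_Ioc fun s hs => ?_
    have : ∀ t, indicator {z : ℝ × ℝ | z.2 ≤ z.1}ᶜ (fun z : ℝ × ℝ => f z.1 * g z.2) (t, s)
        = indicator (Iio s) f t * g s := by
      intro t
      by_cases h : t < s <;> simp [h]
    simp only [this]
    rw [integral_mul_const, integral_indicator measurableSet_Iio, hμ,
      Measure.restrict_restrict measurableSet_Iio, intervalIntegral.integral_of_le hs.1.le,
      integral_Ioc_eq_integral_Ioo]
    congr 3
    ext t; simp only [mem_inter_iff, mem_Iio, mem_Ioo, mem_Ioc]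
    exact ⟨fun h => ⟨h.2.1, h.1⟩, fun h => ⟨h.2, h.1, h.2.le.trans hs.2⟩⟩

/-- The product rule for primitives of integrable functions, in integrated form. -/
theorem mul_sub_mul_eq_integral {u v f g : ℝ → ℂ} {b : ℝ} (hb : 0 ≤ b)
    (hf : IntervalIntegrable f volume 0 b) (hg : IntervalIntegrable g volume 0 b)
    (hu : ∀ x ∈ Icc 0 b, u x = u 0 + ∫ t in (0 : ℝ)..x, f t)
    (hv : ∀ x ∈ Icc 0 b, v x = v 0 + ∫ t in (0 : ℝ)..x, g t) :
    u b * v b - u 0 * v 0 = ∫ s in (0 : ℝ)..b, (f s * v s + u s * g s) := by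
  have h1 := hf.mul_continuousOn (intervalIntegral.continuousOn_primitive_interval' hg left_mem_uIcc)
  have h2 := hg.continuousOn_mul (intervalIntegral.continuousOn_primitive_interval' hf left_mem_uIcc)
  have : ∫ s in (0 : ℝ)..b, (f s * v s + u s * g s) = ∫ s in (0 : ℝ)..b,
      ((f s * (∫ t in (0 : ℝ)..s, g t) + (∫ t in (0 : ℝ)..s, f t) * g s) +
        (f s * v 0 + u 0 * g s)) := by
    refine intervalIntegral.integral_congr fun s hs => ?_
    rw [uIcc_of_le hb] at hs
    simp only [hu s hs, hv s hs]
    ring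
  rw [this, intervalIntegral.integral_add (h1.add h2) ((hf.mul_const _).add (hg.const_mul _)),
    ← integral_mul_integral_eq_add hb hf hg,
    intervalIntegral.integral_add (hf.mul_const _) (hg.const_mul _),
    intervalIntegral.integral_mul_const, intervalIntegral.integral_const_mul,
    hu b ⟨hb, le_rfl⟩, hv b ⟨hb, le_rfl⟩]
  ring

/-! ### Volterra inequalities in exponentially weighted norms. -/

/-- A square integrable weight makes the Volterra operator with kernel `|q|` contractive in an
exponentially weighted norm. -/
theorem exists_weight {q : ℝ → ℂ} (hq2 : Integrable fun s => ‖q s‖ ^ 2)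
    {ε : ℝ} (hε : 0 < ε) :
    ∃ α : ℝ, 0 < α ∧ ∀ x, ∫ s in Iio x, ‖q s‖ * Real.exp (α * s) ≤ ε * Real.exp (α * x) := by
  set A := ∫ s, ‖q s‖ ^ 2 with hA
  have hA0 : 0 ≤ A := integral_nonneg fun s => by positivity
  set c := ε / (A + 1) with hc
  have hc0 : 0 < c := by positivity
  -- The product is split by Young's inequality with parameter `c`. The `‖q‖²` part costs `c A / 2 ≤
  -- ε / 2`; the exponential part costs `1 / (4 c α)`, and this `α` makes it exactly `ε / 2`.
  refine ⟨1 / (2 * c * ε), by positivity, fun x => ?_⟩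
  set α := 1 / (2 * c * ε) with hα
  have hα0 : 0 < α := by positivity
  have hpt : ∀ s, ‖q s‖ * Real.exp (α * s) ≤
      Real.exp (α * x) * (c / 2) * ‖q s‖ ^ 2 +
      (1 / (2 * c) * Real.exp (-(α * x))) * Real.exp ((2 * α) * s) := by
    intro s
    have e1 : Real.exp (2 * α * s) = Real.exp (α * s) ^ 2 := by
      rw [← Real.exp_nat_mul]; congr 1; push_cast; ring
    rw [e1, Real.exp_neg]
    set X := Real.exp (α * x)
    set Y := Real.exp (α * s)
    have hX : 0 < X := Real.exp_pos _
    have : Real.exp (α * x) * (c / 2) * ‖q s‖ ^ 2 + (1 / (2 * c) * X⁻¹) * Y ^ 2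
        - ‖q s‖ * Y = (X * c * ‖q s‖ - Y) ^ 2 / (2 * c * X) := by
      change X * (c / 2) * ‖q s‖ ^ 2 + (1 / (2 * c) * X⁻¹) * Y ^ 2 - ‖q s‖ * Y = _
      field_simp
      ring
    have h2 : 0 ≤ (X * c * ‖q s‖ - Y) ^ 2 / (2 * c * X) := by positivity
    linarith
  have hi : IntegrableOn (fun s => Real.exp ((2 * α) * s)) (Iio x) :=
    (integrableOn_exp_mul_Iic (by positivity) x).mono_set Iio_subset_Iic_self
  have hbd : IntegrableOn (fun s => Real.exp (α * x) * (c / 2) * ‖q s‖ ^ 2 +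
      (1 / (2 * c) * Real.exp (-(α * x))) * Real.exp ((2 * α) * s)) (Iio x) :=
    (hq2.integrableOn.const_mul _).add (hi.const_mul _)
  calc ∫ s in Iio x, ‖q s‖ * Real.exp (α * s)
      ≤ ∫ s in Iio x, (Real.exp (α * x) * (c / 2) * ‖q s‖ ^ 2 +
      (1 / (2 * c) * Real.exp (-(α * x))) * Real.exp ((2 * α) * s)) := by
        refine integral_mono_of_nonneg (.of_forall fun s => by positivity) hbd
          (.of_forall hpt)
    _ = Real.exp (α * x) * (c / 2) * (∫ s in Iio x, ‖q s‖ ^ 2) +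
      (1 / (2 * c) * Real.exp (-(α * x))) * (Real.exp (2 * α * x) / (2 * α)) := by
        rw [integral_add (hq2.integrableOn.const_mul _) (hi.const_mul _), integral_const_mul,
          integral_const_mul, ← integral_Iic_eq_integral_Iio (f := fun s => Real.exp (2 * α * s)),
          integral_exp_mul_Iic (by positivity)]
    _ ≤ Real.exp (α * x) * (c / 2) * A +
      (1 / (2 * c) * Real.exp (-(α * x))) * (Real.exp (2 * α * x) / (2 * α)) := by
        gcongr
        exact setIntegral_le_integral hq2 (.of_forall fun s => by positivity)
    _ ≤ ε * Real.exp (α * x) := by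
        have e1 : Real.exp (2 * α * x) = Real.exp (α * x) ^ 2 := by
          rw [← Real.exp_nat_mul]; congr 1; push_cast; ring
        rw [e1, Real.exp_neg]
        set X := Real.exp (α * x)
        have hX : 0 < X := Real.exp_pos _
        have h1 : (1 / (2 * c) * X⁻¹) * (X ^ 2 / (2 * α)) = ε / 2 * X := by
          rw [hα]; field_simp
        have h2 : c * A ≤ ε := by
          rw [hc, div_mul_eq_mul_div, div_le_iff₀ (by positivity)]
          nlinarith
        rw [h1]
        nlinarith

/-- Uniqueness for homogeneous Volterra inequalities. -/
theorem eq_zero_of_volterra {q : ℝ → ℂ} (hq : Integrable q) (hq2 : Integrable fun s => ‖q s‖ ^ 2)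
    {u : ℝ → ℂ} {b C M : ℝ} (hC : 0 ≤ C) (hM : ∀ x ∈ Icc 0 b, ‖u x‖ ≤ M)
    (hu : ∀ x ∈ Icc 0 b, ‖u x‖ ≤ C * ∫ s in Ioc 0 x, ‖q s‖ * ‖u s‖) :
    ∀ x ∈ Icc 0 b, u x = 0 := by
  -- With this `ε` each substitution of the bound into the inequality gains a factor `C / (2 (C +
  -- 1)) ≤ 1 / 2`; the `+ 1` covers `C = 0`.
  obtain ⟨α, hα, hw⟩ := exists_weight hq2 (ε := 1 / (2 * (C + 1))) (by positivity)
  have step : ∀ n : ℕ, ∀ x ∈ Icc 0 b, ‖u x‖ ≤ (|M| * (1 / 2) ^ n) * Real.exp (α * x) := by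
    intro n
    induction n with
    | zero =>
      intro x hx
      have : 1 ≤ Real.exp (α * x) := Real.one_le_exp (mul_nonneg hα.le hx.1)
      have h1 := (hM x hx).trans (le_abs_self M)
      have := abs_nonneg M
      simp only [pow_zero, mul_one]
      nlinarith
    | succ n ih =>
      intro x hx
      set D := |M| * (1 / 2) ^ n with hD
      have hD0 : 0 ≤ D := by positivity
      have hint : IntegrableOn (fun s => D * (‖q s‖ * Real.exp (α * s))) (Ioc 0 x) := by
        refine Integrable.const_mul ?_ _
        refine (hq.norm.integrableOn (s := Icc 0 x)).mul_continuousOn (by fun_prop)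
          isCompact_Icc |>.mono_set Ioc_subset_Icc_self
      have hint' : IntegrableOn (fun s => (‖q s‖ * Real.exp (α * s))) (Iic x) := by
        refine Integrable.mul_bdd (c := Real.exp (α * x)) hq.norm.integrableOn (by fun_prop) ?_
        filter_upwards [ae_restrict_mem measurableSet_Iic] with s hs
        rw [Real.norm_eq_abs, Real.abs_exp]
        exact Real.exp_le_exp.2 (mul_le_mul_of_nonneg_left hs hα.le)
      calc ‖u x‖ ≤ C * ∫ s in Ioc 0 x, ‖q s‖ * ‖u s‖ := hu x hx
        _ ≤ C * ∫ s in Ioc 0 x, D * (‖q s‖ * Real.exp (α * s)) := by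
          refine mul_le_mul_of_nonneg_left ?_ hC
          refine integral_mono_of_nonneg (.of_forall fun s => by positivity) hint ?_
          filter_upwards [ae_restrict_mem measurableSet_Ioc] with s hs
          have := ih s ⟨hs.1.le, hs.2.trans hx.2⟩
          calc ‖q s‖ * ‖u s‖ ≤ ‖q s‖ * (D * Real.exp (α * s)) := by gcongr
            _ = _ := by ring
        _ ≤ C * (D * ∫ s in Iio x, ‖q s‖ * Real.exp (α * s)) := by
          rw [integral_const_mul, ← integral_Iic_eq_integral_Iio]
          refine mul_le_mul_of_nonneg_left (mul_le_mul_of_nonneg_left ?_ hD0) hC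
          refine setIntegral_mono_set hint' (.of_forall fun s => by positivity) ?_
          exact (Ioc_subset_Iic_self).eventuallyLE
        _ ≤ C * (D * (1 / (2 * (C + 1)) * Real.exp (α * x))) := by gcongr; exact hw x
        _ = (C / (C + 1)) * (D * (1 / 2) * Real.exp (α * x)) := by field_simp
        _ ≤ 1 * (D * (1 / 2) * Real.exp (α * x)) := by
          gcongr
          rw [div_le_one (by positivity)]; linarith
        _ = _ := by rw [hD, pow_succ]; ring
  intro x hx
  have hlim : Filter.Tendsto (fun n : ℕ => (|M| * (1 / 2 : ℝ) ^ n) * Real.exp (α * x))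
      Filter.atTop (nhds ((|M| * 0) * Real.exp (α * x))) :=
    ((tendsto_pow_atTop_nhds_zero_of_lt_one (by norm_num) (by norm_num)).const_mul _).mul_const _
  have := ge_of_tendsto' hlim fun n => step n x hx
  simpa using this

/-! ### The free solutions `cos (l x)` and `sin (l x) / l`. -/

/-- `sin (l r) / l`, extended continuously to `l = 0`. -/
noncomputable def sinDiv (l : ℂ) (r : ℝ) : ℂ := ∫ u in (0 : ℝ)..r, Complex.cos (l * u)

theorem hasDerivAt_sinDiv (l : ℂ) (r : ℝ) : HasDerivAt (sinDiv l) (Complex.cos (l * r)) r := by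
  have hc : Continuous fun u : ℝ => Complex.cos (l * u) := by fun_prop
  exact intervalIntegral.integral_hasDerivAt_right (hc.intervalIntegrable _ _)
    (hc.stronglyMeasurableAtFilter _ _) hc.continuousAt

theorem continuous_sinDiv (l : ℂ) : Continuous (sinDiv l) :=
  continuous_iff_continuousAt.2 fun r => (hasDerivAt_sinDiv l r).continuousAt

theorem hasDerivAt_cos_mul (l : ℂ) (r : ℝ) :
    HasDerivAt (fun u : ℝ => Complex.cos (l * u)) (-(Complex.sin (l * r) * l)) r := by
  have h1 : HasDerivAt (fun u : ℝ => l * (u : ℂ)) l r := by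
    simpa using (Complex.ofRealCLM.hasDerivAt (x := r)).const_mul l
  have := (Complex.hasDerivAt_cos (l * r)).comp r h1
  exact this.congr_deriv (by ring)

theorem mul_sinDiv (l : ℂ) (r : ℝ) : l * sinDiv l r = Complex.sin (l * r) := by
  have h : ∀ u ∈ uIcc 0 r, HasDerivAt (fun u : ℝ => Complex.sin (l * u))
      (l * Complex.cos (l * u)) u := by
    intro u _
    have h1 : HasDerivAt (fun u : ℝ => l * (u : ℂ)) l u := by
      simpa using (Complex.ofRealCLM.hasDerivAt (x := u)).const_mul l
    have := (Complex.hasDerivAt_sin (l * u)).comp u h1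
    exact this.congr_deriv (by ring)
  have hc : Continuous fun u : ℝ => l * Complex.cos (l * u) := by fun_prop
  have := intervalIntegral.integral_eq_sub_of_hasDerivAt h (hc.intervalIntegrable _ _)
  rw [intervalIntegral.integral_const_mul] at this
  simpa [sinDiv] using this

theorem hasDerivAt_cos_mul_sub (l : ℂ) (x s : ℝ) :
    HasDerivAt (fun s : ℝ => Complex.cos (l * ((x - s : ℝ) : ℂ))) (l ^ 2 * sinDiv l (x - s)) s := by
  have h := (hasDerivAt_cos_mul l (x - s)).scomp s ((hasDerivAt_id s).const_sub x)
  refine h.congr_deriv ?_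
  rw [← mul_sinDiv]
  simp
  ring

theorem hasDerivAt_sinDiv_sub (l : ℂ) (x s : ℝ) :
    HasDerivAt (fun s : ℝ => sinDiv l (x - s)) (-Complex.cos (l * ((x - s : ℝ) : ℂ))) s := by
  have h := (hasDerivAt_sinDiv l (x - s)).scomp s ((hasDerivAt_id s).const_sub x)
  exact h.congr_deriv (by simp)

theorem eq_add_integral_of_hasDerivAt {v g : ℝ → ℂ} (h : ∀ s, HasDerivAt v (g s) s)
    (hg : Continuous g) (x : ℝ) : v x = v 0 + ∫ t in (0 : ℝ)..x, g t := by
  rw [intervalIntegral.integral_eq_sub_of_hasDerivAt (fun s _ => h s) (hg.intervalIntegrable _ _)]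
  ring

/-! ### Solutions of the differential equation: Lagrange identity, variation of parameters,
uniqueness. -/

namespace IsSolution

variable {b : ℝ} {q : ℝ → ℝ} {z : ℂ} {y p : ℝ → ℂ}

theorem continuousOn (H : IsSolution b q z y p) : ContinuousOn y (Icc 0 b) :=
  fun x hx => (H.hasDeriv x hx).continuousWithinAt

theorem intervalIntegrable (H : IsSolution b q z y p) (hb : 0 ≤ b)
    (hq : IntegrableOn q (Ioc 0 b)) :
    IntervalIntegrable (fun t => ((q t : ℂ) - z) * y t) volume 0 b := by
  have h1 : IntervalIntegrable (fun t => ((q t : ℂ) - z)) volume 0 b :=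
    ((intervalIntegrable_iff_integrableOn_Ioc_of_le hb).2 (Integrable.ofReal (𝕜 := ℂ) hq)).sub intervalIntegrable_const
  exact h1.mul_continuousOn (by rw [uIcc_of_le hb]; exact H.continuousOn)

theorem continuousOn_deriv (H : IsSolution b q z y p) (hb : 0 ≤ b)
    (hq : IntegrableOn q (Ioc 0 b)) : ContinuousOn p (Icc 0 b) := by
  have := intervalIntegral.continuousOn_primitive_interval' (H.intervalIntegrable hb hq)
    left_mem_uIcc
  rw [uIcc_of_le hb] at this
  exact (continuousOn_const.add this).congr H.deriv_eq

theorem eq_add_integral (H : IsSolution b q z y p) (hb : 0 ≤ b)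
    (hq : IntegrableOn q (Ioc 0 b)) :
    ∀ x ∈ Icc 0 b, y x = y 0 + ∫ t in (0 : ℝ)..x, p t := by
  intro x hx
  have hsub : Icc 0 x ⊆ Icc 0 b := Icc_subset_Icc le_rfl hx.2
  rw [intervalIntegral.integral_eq_sub_of_hasDerivAt_of_le hx.1 (H.continuousOn.mono hsub)
    (fun s hs => (H.hasDeriv s (hsub (Ioo_subset_Icc_self hs))).hasDerivAt
      (Icc_mem_nhds hs.1 (hs.2.trans_le hx.2)))]
  · ring
  · refine ContinuousOn.intervalIntegrable ?_
    rw [uIcc_of_le hx.1]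
    exact (H.continuousOn_deriv hb hq).mono hsub

theorem congr (H : IsSolution b q z y p) {q' : ℝ → ℝ}
    (h : ∀ᵐ x ∂volume.restrict (Ioc 0 b), q x = q' x) : IsSolution b q' z y p := by
  refine ⟨H.hasDeriv, fun x hx => ?_⟩
  rw [H.deriv_eq x hx, intervalIntegral.integral_of_le hx.1, intervalIntegral.integral_of_le hx.1]
  congr 1
  refine integral_congr_ae ?_
  filter_upwards [ae_restrict_of_ae_restrict_of_subset (Ioc_subset_Ioc_right hx.2) h] with t ht
  rw [ht]

theorem mono (H : IsSolution b q z y p) {c : ℝ} (hc : c ≤ b) : IsSolution c q z y p :=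
  ⟨fun x hx => (H.hasDeriv x ⟨hx.1, hx.2.trans hc⟩).mono (Icc_subset_Icc_right hc),
    fun x hx => H.deriv_eq x ⟨hx.1, hx.2.trans hc⟩⟩

/-- The Lagrange identity. -/
theorem wronskian {q' : ℝ → ℝ} {y' p' : ℝ → ℂ} (H : IsSolution b q z y p)
    (H' : IsSolution b q' z y' p') (hb : 0 ≤ b) (hq : IntegrableOn q (Ioc 0 b))
    (hq' : IntegrableOn q' (Ioc 0 b)) :
    y b * p' b - p b * y' b = y 0 * p' 0 - p 0 * y' 0 +
      ∫ s in (0 : ℝ)..b, ((q' s : ℂ) - q s) * (y s * y' s) := by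
  have hy := H.eq_add_integral hb hq
  have hy' := H'.eq_add_integral hb hq'
  have ip : IntervalIntegrable p volume 0 b := ContinuousOn.intervalIntegrable <| by
    rw [uIcc_of_le hb]; exact H.continuousOn_deriv hb hq
  have ip' : IntervalIntegrable p' volume 0 b := ContinuousOn.intervalIntegrable <| by
    rw [uIcc_of_le hb]; exact H'.continuousOn_deriv hb hq'
  have cy : ContinuousOn y (uIcc 0 b) := by rw [uIcc_of_le hb]; exact H.continuousOn
  have cy' : ContinuousOn y' (uIcc 0 b) := by rw [uIcc_of_le hb]; exact H'.continuousOn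
  have cp : ContinuousOn p (uIcc 0 b) := by rw [uIcc_of_le hb]; exact H.continuousOn_deriv hb hq
  have cp' : ContinuousOn p' (uIcc 0 b) := by
    rw [uIcc_of_le hb]; exact H'.continuousOn_deriv hb hq'
  have i1 := H.intervalIntegrable hb hq
  have i1' := H'.intervalIntegrable hb hq'
  have e1 := mul_sub_mul_eq_integral hb ip i1' hy H'.deriv_eq
  have e2 := mul_sub_mul_eq_integral hb i1 ip' H.deriv_eq hy'
  have e3 : ∫ s in (0 : ℝ)..b, ((q' s : ℂ) - q s) * (y s * y' s) =
      (∫ s in (0 : ℝ)..b, (p s * p' s + y s * (((q' s : ℂ) - z) * y' s))) -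
      ∫ s in (0 : ℝ)..b, ((((q s : ℂ) - z) * y s) * y' s + p s * p' s) := by
    rw [← intervalIntegral.integral_sub
      ((ip.mul_continuousOn cp').add (i1'.continuousOn_mul cy))
      ((i1.mul_continuousOn cy').add (ip.mul_continuousOn cp'))]
    exact intervalIntegral.integral_congr fun s _ => by ring
  rw [e3, ← e1, ← e2]
  ring

/-- Variation of parameters. -/
theorem eq_volterra {l : ℂ} (H : IsSolution b q (l ^ 2) y p)
    (hq : IntegrableOn q (Ioc 0 b)) : ∀ x ∈ Icc 0 b, y x = y 0 * Complex.cos (l * x) +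
      p 0 * sinDiv l x + ∫ s in Ioc 0 x, sinDiv l (x - s) * q s * y s := by
  intro x hx
  replace hq := hq.mono_set (Ioc_subset_Ioc_right hx.2)
  replace H := H.mono hx.2
  have hb := hx.1
  have ip : IntervalIntegrable p volume 0 x := ContinuousOn.intervalIntegrable <| by
    rw [uIcc_of_le hb]; exact H.continuousOn_deriv hb hq
  have cy : ContinuousOn y (uIcc 0 x) := by rw [uIcc_of_le hb]; exact H.continuousOn
  have i1 := H.intervalIntegrable hb hq
  have cS : Continuous fun s => sinDiv l (x - s) := (continuous_sinDiv l).comp (by fun_prop)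
  have cC : Continuous fun s : ℝ => Complex.cos (l * ((x - s : ℝ) : ℂ)) := by fun_prop
  -- The function `p(s) sinDiv l (x - s) + y(s) cos (l (x - s))` has derivative `q y sinDiv l (x -
  -- s)`: the `l ^ 2` terms and the `p cos` terms cancel. Its values at `s = 0` and `s = x` give the
  -- formula.
  have e1 := mul_sub_mul_eq_integral hb i1 (cC.neg.intervalIntegrable _ _) H.deriv_eq
    (fun s _ => eq_add_integral_of_hasDerivAt (hasDerivAt_sinDiv_sub l x) cC.neg s)
  have e2 := mul_sub_mul_eq_integral hb ip ((cS.const_mul (l ^ 2)).intervalIntegrable _ _)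
    (H.eq_add_integral hb hq)
    (fun s _ => eq_add_integral_of_hasDerivAt (hasDerivAt_cos_mul_sub l x) (cS.const_mul (l ^ 2)) s)
  have e3 : ∫ s in Ioc 0 x, sinDiv l (x - s) * q s * y s =
      (∫ s in (0 : ℝ)..x, (((q s : ℂ) - l ^ 2) * y s * sinDiv l (x - s) +
        p s * -Complex.cos (l * ((x - s : ℝ) : ℂ)))) +
      ∫ s in (0 : ℝ)..x, (p s * Complex.cos (l * ((x - s : ℝ) : ℂ)) +
        y s * (l ^ 2 * sinDiv l (x - s))) := by
    have j1 := (i1.mul_continuousOn cS.continuousOn).add (ip.mul_continuousOn cC.neg.continuousOn)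
    have j2 := (ip.mul_continuousOn cC.continuousOn).add
      ((cy.mul (cS.const_mul (l ^ 2)).continuousOn).intervalIntegrable)
    rw [← intervalIntegral.integral_of_le hb]
    refine Eq.trans ?_ (intervalIntegral.integral_add j1 j2)
    exact intervalIntegral.integral_congr fun s _ => by ring
  have hS0 : sinDiv l 0 = 0 := by simp [sinDiv]
  rw [e3]
  simp only [Pi.neg_apply] at e1
  rw [← e1, ← e2]
  simp [hS0]

/-- With zero Cauchy data the variation of parameters formula becomes a homogeneous Volterra
equation, and `sinDiv l` is bounded on `[0, b]`. -/
theorem eq_zero_of_left (H : IsSolution b q z y p)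
    (hq : MemLp q 2 (volume.restrict (Ioc 0 b))) (hy : y 0 = 0) (hp : p 0 = 0) :
    ∀ x ∈ Icc 0 b, y x = 0 := by
  obtain ⟨l, rfl⟩ : ∃ l : ℂ, z = l ^ 2 := ⟨z ^ (2⁻¹ : ℂ), by simp⟩
  have hq1 : IntegrableOn q (Ioc 0 b) := hq.integrable (by norm_num)
  set Q : ℝ → ℂ := (Ioc 0 b).indicator fun s => (q s : ℂ) with hQ
  have hQ1 : Integrable Q := (integrable_indicator_iff measurableSet_Ioc).2 hq1.ofReal
  have hQ2 : Integrable fun s => ‖Q s‖ ^ 2 := by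
    have : (fun s => ‖Q s‖ ^ 2) = (Ioc 0 b).indicator fun s => ‖q s‖ ^ 2 := by
      ext s; by_cases h : s ∈ Ioc 0 b <;> simp [hQ, h]
    rw [this]
    exact (integrable_indicator_iff measurableSet_Ioc).2 (hq.integrable_norm_pow two_ne_zero)
  obtain ⟨M, hM⟩ := isCompact_Icc.exists_bound_of_continuousOn H.continuousOn
  obtain ⟨C, hC⟩ := (isCompact_Icc (a := (0 : ℝ)) (b := b)).exists_bound_of_continuousOn
    (continuous_sinDiv l).continuousOn
  refine eq_zero_of_volterra hQ1 hQ2 (abs_nonneg C) hM fun x hx => ?_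
  rw [H.eq_volterra hq1 x hx, hy, hp, ← integral_const_mul]
  simp only [zero_mul, zero_add]
  have hsub : Ioc 0 x ⊆ Ioc 0 b := Ioc_subset_Ioc_right hx.2
  refine norm_integral_le_of_norm_le ?_ ?_
  · refine Integrable.const_mul ?_ _
    have h1 : IntegrableOn (fun s => ‖Q s‖ * ‖y s‖) (Icc 0 x) :=
      hQ1.norm.integrableOn.mul_continuousOn
        (H.continuousOn.norm.mono (Icc_subset_Icc_right hx.2)) isCompact_Icc
    exact h1.mono_set Ioc_subset_Icc_self
  · filter_upwards [ae_restrict_mem measurableSet_Ioc] with s hs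
    have : Q s = q s := by simp [hQ, hsub hs]
    rw [this, norm_mul, norm_mul, mul_assoc]
    gcongr
    exact (hC _ ⟨by linarith [hs.2], by linarith [hs.1, hx.2]⟩).trans (le_abs_self C)

/-- Turns uniqueness from the left end into uniqueness from the right end, which is needed on the
second edge, where matching prescribes the data at the junction. -/
theorem reflect (H : IsSolution b q z y p) (hb : 0 ≤ b) (hq : IntegrableOn q (Ioc 0 b)) :
    IsSolution b (fun x => q (b - x)) z (fun x => y (b - x)) (fun x => -p (b - x)) := by
  have hmaps : MapsTo (fun x => b - x) (Icc 0 b) (Icc 0 b) :=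
    fun x hx => ⟨by linarith [hx.2], by linarith [hx.1]⟩
  refine ⟨fun x hx => ?_, fun x hx => ?_⟩
  · have := (H.hasDeriv (b - x) (hmaps hx)).scomp x
      (((hasDerivAt_id x).const_sub b).hasDerivWithinAt (s := Icc 0 b)) hmaps
    exact this.congr_deriv (by simp)
  · have hi := H.intervalIntegrable hb hq
    have e := intervalIntegral.integral_comp_sub_left
      (f := fun t => ((q t : ℂ) - z) * y t) (a := 0) (b := x) b
    rw [e, H.deriv_eq _ (hmaps hx), sub_zero, H.deriv_eq b ⟨hb, le_rfl⟩]
    have hi1 : IntervalIntegrable (fun t => ((q t : ℂ) - z) * y t) volume 0 (b - x) :=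
      hi.mono_set (by rw [uIcc_of_le hb, uIcc_of_le (hmaps hx).1]
                      exact Icc_subset_Icc_right (hmaps hx).2)
    rw [← intervalIntegral.integral_interval_sub_left hi hi1]
    ring

theorem eq_zero_of_right (H : IsSolution b q z y p) (hb : 0 ≤ b)
    (hq : MemLp q 2 (volume.restrict (Ioc 0 b))) (hy : y b = 0) (hp : p b = 0) :
    ∀ x ∈ Icc 0 b, y x = 0 := by
  have hmp : MeasurePreserving (fun x => b - x) (volume.restrict (Ico 0 b))
      (volume.restrict (Ioc 0 b)) := by
    have := (volume.measurePreserving_sub_left b).restrict_preimage (s := Ioc 0 b)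
      measurableSet_Ioc
    simpa using this
  have hq' : MemLp (fun x => q (b - x)) 2 (volume.restrict (Ioc 0 b)) := by
    rw [← restrict_Ico_eq_restrict_Ioc]
    exact hq.comp_measurePreserving hmp
  have := (H.reflect hb (hq.integrable (by norm_num))).eq_zero_of_left hq'
    (by simpa using hy) (by simpa using hp)
  intro x hx
  simpa using this (b - x) ⟨by linarith [hx.2], by linarith [hx.1]⟩

end IsSolution

/-! ### Exponentials, boxes and spreading over light cones. -/

/-- The wave `exp (i l v)`. -/
noncomputable def wave (l : ℂ) (v : ℝ) : ℂ := Complex.exp (Complex.I * l * v)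

theorem continuous_wave (l : ℂ) : Continuous (wave l) := by unfold wave; fun_prop

theorem wave_add (l : ℂ) (u v : ℝ) : wave l (u + v) = wave l u * wave l v := by
  simp only [wave, ← Complex.exp_add]; congr 1; push_cast; ring

theorem wave_add_wave_neg (l : ℂ) (v : ℝ) : wave l v + wave l (-v) = 2 * Complex.cos (l * v) := by
  rw [Complex.two_cos]
  simp only [wave]
  congr 2 <;> push_cast <;> ring

/-- The continuation of `sinDiv l` by zero to the negative half-line. -/
noncomputable def sinDivPos (l : ℂ) (r : ℝ) : ℂ := if 0 < r then sinDiv l r else 0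

theorem sinDivPos_of_nonneg (l : ℂ) {r : ℝ} (hr : 0 ≤ r) : sinDivPos l r = sinDiv l r := by
  rcases hr.lt_or_eq with h | rfl
  · simp [sinDivPos, h]
  · simp [sinDivPos, sinDiv]

/-- The bridge from the Volterra equation to `l`-free kernels: translating by `τ` extracts `wave l
τ`, and folding the centred box onto `(0, r)` leaves twice the integral of the cosine. For `r ≤ 0`
the box is empty, hence `sinDivPos`. -/
theorem integral_wave_box (l : ℂ) (r τ : ℝ) :
    ∫ v : ℝ, (if |v - τ| < r then wave l v else 0) = 2 * sinDivPos l r * wave l τ := by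
  have h1 : ∫ v : ℝ, (if |v - τ| < r then wave l v else 0) =
      ∫ u : ℝ, (if |u| < r then wave l u else 0) * wave l τ := by
    rw [← integral_add_right_eq_self (fun v : ℝ => if |v - τ| < r then wave l v else 0) τ]
    refine integral_congr_ae (.of_forall fun u => ?_)
    simp only [add_sub_cancel_right, wave_add, ite_mul, zero_mul]
  rw [h1, integral_mul_const]
  congr 1
  by_cases hr : 0 < r
  · have h2 : (fun u : ℝ => if |u| < r then wave l u else 0) = indicator (Ioo (-r) r) (wave l) := by
      ext u; simp [indicator, abs_lt]
    have hi : ∀ a b, IntervalIntegrable (wave l) volume a b :=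
      fun a b => (continuous_wave l).intervalIntegrable a b
    have hi' : IntervalIntegrable (fun u => wave l (-u)) volume 0 r :=
      ((continuous_wave l).comp continuous_neg).intervalIntegrable _ _
    rw [h2, integral_indicator measurableSet_Ioo, ← integral_Ioc_eq_integral_Ioo,
      ← intervalIntegral.integral_of_le (by linarith),
      ← intervalIntegral.integral_add_adjacent_intervals (hi _ 0) (hi _ _)]
    have h3 := intervalIntegral.integral_comp_neg (a := 0) (b := r) (wave l)
    rw [neg_zero] at h3
    rw [← h3, add_comm, ← intervalIntegral.integral_add (hi _ _) hi',
      sinDivPos, if_pos hr, sinDiv, ← intervalIntegral.integral_const_mul]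
    exact intervalIntegral.integral_congr fun u _ => wave_add_wave_neg l u
  · have h2 : ∀ u : ℝ, ¬ |u| < r := fun u hu => hr ((abs_nonneg u).trans_lt hu)
    simp [h2, sinDivPos, hr]

section Spread

variable {Ω : Type*} [MeasurableSpace Ω]

/-- The mass `f`, placed at the space-time points `(σ, τ)` and spread over their forward light
cones. -/
noncomputable def spread (μ : Measure Ω) (f : Ω → ℂ) (σ τ : Ω → ℝ) (x v : ℝ) : ℂ :=
  ∫ ω, (if |v - τ ω| < x - σ ω then f ω else 0) ∂μ

variable {μ : Measure Ω} {f : Ω → ℂ} {σ τ : Ω → ℝ}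

/-- A source in the forward cone of the origin has its own forward cone inside that cone, by the
triangle inequality. -/
theorem spread_eq_zero (h : ∀ ω, f ω ≠ 0 → |τ ω| ≤ σ ω) {x v : ℝ} (hx : x ≤ |v|) :
    spread μ f σ τ x v = 0 := by
  refine integral_eq_zero_of_ae (.of_forall fun ω => ?_)
  simp only [Pi.zero_apply]
  split_ifs with hω
  · by_contra hf
    have h1 := h ω hf
    have h2 := abs_add_le (v - τ ω) (τ ω)
    rw [sub_add_cancel] at h2
    linarith
  · rfl

/-- Only sources with `σ ω < x` reach level `x`. This causality makes the kernel equation of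
Volterra type in `x`. -/
theorem integral_norm_spread_le (hf : Integrable f μ) (hσ : Measurable σ) (x v : ℝ) :
    ∫ ω, ‖(if |v - τ ω| < x - σ ω then f ω else 0)‖ ∂μ ≤ ∫ ω in {ω | σ ω < x}, ‖f ω‖ ∂μ := by
  have hm : MeasurableSet {ω | σ ω < x} := measurableSet_lt hσ measurable_const
  rw [← integral_indicator hm]
  refine integral_mono_of_nonneg (.of_forall fun _ => norm_nonneg _) (hf.norm.indicator hm)
    (.of_forall fun ω => ?_)
  simp only
  split_ifs with h
  · have : ω ∈ {ω | σ ω < x} := by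
      have := (abs_nonneg _).trans_lt h
      simp only [mem_ofPred_eq]; linarith
    rw [indicator_of_mem this]
  · rw [norm_zero]
    exact indicator_nonneg (fun _ _ => norm_nonneg _) _

theorem norm_spread_le (hf : Integrable f μ) (hσ : Measurable σ) (x v : ℝ) :
    ‖spread μ f σ τ x v‖ ≤ ∫ ω in {ω | σ ω < x}, ‖f ω‖ ∂μ :=
  (norm_integral_le_integral_norm _).trans (integral_norm_spread_le hf hσ x v)

theorem measurableSet_cone (hσ : Measurable σ) (hτ : Measurable τ) :
    MeasurableSet {z : (ℝ × ℝ) × Ω | |z.1.2 - τ z.2| < z.1.1 - σ z.2} := by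
  refine measurableSet_lt ?_ ?_
  · exact (measurable_fst.snd.sub (hτ.comp measurable_snd)).abs
  · exact measurable_fst.fst.sub (hσ.comp measurable_snd)

theorem measurable_spread [SFinite μ] (hf : Measurable f) (hσ : Measurable σ) (hτ : Measurable τ) :
    Measurable (Function.uncurry (spread μ f σ τ)) := by
  have h : Measurable fun z : (ℝ × ℝ) × Ω =>
      if |z.1.2 - τ z.2| < z.1.1 - σ z.2 then f z.2 else 0 :=
    Measurable.ite (measurableSet_cone hσ hτ) (hf.comp measurable_snd) measurable_const
  exact h.stronglyMeasurable.integral_prod_right'.measurable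

/-- Where the integrand is nonzero, `|v| < x`, so the wave is bounded there and `‖f‖` times the
indicator of a compact interval dominates. -/
theorem integrable_spread_kernel_mul_wave [SFinite μ] (hf : Measurable f) (hfi : Integrable f μ)
    (hσ : Measurable σ) (hτ : Measurable τ) (h : ∀ ω, f ω ≠ 0 → |τ ω| ≤ σ ω) (x : ℝ) (l : ℂ) :
    Integrable (fun z : ℝ × Ω =>
      (if |z.1 - τ z.2| < x - σ z.2 then f z.2 else 0) * wave l z.1) (volume.prod μ) := by
  obtain ⟨C, hC⟩ := (isCompact_Icc (a := -x) (b := x)).exists_bound_of_continuousOn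
    (continuous_wave l).continuousOn
  have hmeas : Measurable fun z : ℝ × Ω =>
      (if |z.1 - τ z.2| < x - σ z.2 then f z.2 else 0) * wave l z.1 := by
    refine (Measurable.ite ?_ (hf.comp measurable_snd) measurable_const).mul
      ((continuous_wave l).measurable.comp measurable_fst)
    exact measurableSet_lt (measurable_fst.sub (hτ.comp measurable_snd)).abs
      (measurable_const.sub (hσ.comp measurable_snd))
  have hdom : Integrable (fun z : ℝ × Ω => (indicator (Icc (-x) x) (fun _ => |C|) z.1) * ‖f z.2‖)
      (volume.prod μ) := by
    refine Integrable.mul_prod ?_ hfi.norm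
    exact (integrable_indicator_iff measurableSet_Icc).2
      (integrableOn_const (by simp))
  refine hdom.mono' hmeas.aestronglyMeasurable (.of_forall fun z => ?_)
  have hnn : 0 ≤ (indicator (Icc (-x) x) (fun _ => |C|) z.1) * ‖f z.2‖ :=
    mul_nonneg (indicator_nonneg (fun _ _ => abs_nonneg _) _) (norm_nonneg _)
  split_ifs with hz
  · by_cases hfz : f z.2 = 0
    · simp [hfz]
    · have h1 := h _ hfz
      have h2 := abs_add_le (z.1 - τ z.2) (τ z.2)
      rw [sub_add_cancel] at h2
      have h3 : z.1 ∈ Icc (-x) x := abs_le.1 (by linarith)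
      rw [indicator_of_mem h3, norm_mul, mul_comm]
      gcongr
      exact (hC _ h3).trans (le_abs_self C)
  · simpa using hnn

theorem integrable_spread_mul_wave [SFinite μ] (hf : Measurable f) (hfi : Integrable f μ)
    (hσ : Measurable σ) (hτ : Measurable τ) (h : ∀ ω, f ω ≠ 0 → |τ ω| ≤ σ ω) (x : ℝ) (l : ℂ) :
    Integrable fun v => spread μ f σ τ x v * wave l v := by
  have := (integrable_spread_kernel_mul_wave hf hfi hσ hτ h x l).integral_prod_left
  simpa only [integral_mul_const, spread] using this

/-- Fubini followed by `integral_wave_box`: the Fourier integral of a spread source is a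
superposition of the Volterra kernels `sin (l (x - σ)) / l`. -/
theorem integral_spread_mul_wave [SFinite μ] (hf : Measurable f) (hfi : Integrable f μ)
    (hσ : Measurable σ) (hτ : Measurable τ) (h : ∀ ω, f ω ≠ 0 → |τ ω| ≤ σ ω) (x : ℝ) (l : ℂ) :
    ∫ v, spread μ f σ τ x v * wave l v =
      ∫ ω, f ω * (2 * sinDivPos l (x - σ ω) * wave l (τ ω)) ∂μ := by
  calc ∫ v, spread μ f σ τ x v * wave l v
      = ∫ v, ∫ ω, (if |v - τ ω| < x - σ ω then f ω else 0) * wave l v ∂μ := by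
        simp only [integral_mul_const, spread]
    _ = ∫ ω, (∫ v, (if |v - τ ω| < x - σ ω then f ω else 0) * wave l v) ∂μ :=
        integral_integral_swap (integrable_spread_kernel_mul_wave hf hfi hσ hτ h x l)
    _ = _ := by
        refine integral_congr_ae (.of_forall fun ω => ?_)
        simp only
        rw [← integral_wave_box, ← integral_const_mul]
        refine integral_congr_ae (.of_forall fun v => ?_)
        simp only
        split_ifs <;> simp

end Spread

/-! ### Kernels supported in the light cone. -/

/-- A measurable kernel supported in the light cone `|v| < x` and bounded for `x ≤ d`. -/
structure ConeKernel (d C : ℝ) (k : ℝ → ℝ → ℂ) : Prop where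
  measurable : Measurable (Function.uncurry k)
  bound : ∀ x ≤ d, ∀ v, ‖k x v‖ ≤ C
  support : ∀ x v, x ≤ |v| → k x v = 0

namespace ConeKernel

variable {d C : ℝ} {k : ℝ → ℝ → ℂ}

theorem nonneg (H : ConeKernel d C k) : 0 ≤ C := (norm_nonneg _).trans (H.bound d le_rfl 0)

theorem norm_le_indicator (H : ConeKernel d C k) {x : ℝ} (hx : x ≤ d) (v : ℝ) :
    ‖k x v‖ ≤ indicator (Icc (-d) d) (fun _ => C) v := by
  by_cases hv : v ∈ Icc (-d) d
  · rw [indicator_of_mem hv]; exact H.bound x hx v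
  · rw [indicator_of_notMem hv, H.support x v, norm_zero]
    by_contra h
    exact hv (abs_le.1 (by linarith))

theorem measurable_right (H : ConeKernel d C k) (x : ℝ) : Measurable (k x) :=
  H.measurable.comp measurable_prodMk_left

theorem integrable_indicator_const (d C : ℝ) :
    Integrable (indicator (Icc (-d) d) (fun _ => C)) :=
  (integrable_indicator_iff measurableSet_Icc).2 (integrableOn_const (by simp))

theorem norm_mul_wave_le (H : ConeKernel d C k) {l : ℂ} {M : ℝ}
    (hM : ∀ v ∈ Icc (-d) d, ‖wave l v‖ ≤ M) {x : ℝ} (hx : x ≤ d) (v : ℝ) :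
    ‖k x v * wave l v‖ ≤ indicator (Icc (-d) d) (fun _ => C * M) v := by
  have h := H.norm_le_indicator hx v
  rw [norm_mul]
  by_cases hv : v ∈ Icc (-d) d
  · rw [indicator_of_mem hv] at h ⊢
    exact mul_le_mul h (hM v hv) (norm_nonneg _) H.nonneg
  · rw [indicator_of_notMem hv] at h ⊢
    rw [le_antisymm h (norm_nonneg _), zero_mul]

theorem integrable_mul_wave (H : ConeKernel d C k) (l : ℂ) {x : ℝ} (hx : x ≤ d) :
    Integrable fun v => k x v * wave l v := by
  obtain ⟨M, hM⟩ := (isCompact_Icc (a := -d) (b := d)).exists_bound_of_continuousOn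
    (continuous_wave l).continuousOn
  exact (integrable_indicator_const d (C * M)).mono'
    ((H.measurable_right x).mul (continuous_wave l).measurable).aestronglyMeasurable
    (.of_forall (H.norm_mul_wave_le hM hx))

theorem measurable_transform (H : ConeKernel d C k) (l : ℂ) :
    Measurable fun x => ∫ v, k x v * wave l v := by
  have : Measurable fun z : ℝ × ℝ => k z.1 z.2 * wave l z.2 :=
    H.measurable.mul ((continuous_wave l).measurable.comp measurable_snd)
  exact this.stronglyMeasurable.integral_prod_right'.measurable

theorem exists_bound_transform (H : ConeKernel d C k) (l : ℂ) :
    ∃ M, ∀ x ≤ d, ‖∫ v, k x v * wave l v‖ ≤ M := by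
  obtain ⟨M, hM⟩ := (isCompact_Icc (a := -d) (b := d)).exists_bound_of_continuousOn
    (continuous_wave l).continuousOn
  exact ⟨_, fun x hx => norm_integral_le_of_norm_le (integrable_indicator_const d (C * M))
    (.of_forall (H.norm_mul_wave_le hM hx))⟩

/-- Multiplication of the source coordinate by a weight vanishing for `s > d`. -/
theorem integrable_weight_mul (H : ConeKernel d C k) {q : ℝ → ℂ} (hqm : Measurable q)
    (hq : Integrable q) (hq0 : ∀ s, d < s → q s = 0) :
    Integrable (fun ω : ℝ × ℝ => q ω.1 * k ω.1 ω.2 / 2) (volume.prod volume) := by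
  have h : Integrable (fun ω : ℝ × ℝ => ‖q ω.1‖ * indicator (Icc (-d) d) (fun _ => C) ω.2)
      (volume.prod volume) := hq.norm.mul_prod (integrable_indicator_const d C)
  refine Integrable.div_const ?_ _
  refine h.mono' ((hqm.comp measurable_fst).mul H.measurable).aestronglyMeasurable
    (.of_forall fun ω => ?_)
  rw [norm_mul]
  by_cases hs : ω.1 ≤ d
  · gcongr
    exact H.norm_le_indicator hs _
  · simp [hq0 _ (not_le.1 hs)]

end ConeKernel

/-! ### Construction of the transformation kernel by Picard iteration. -/

/-- The inhomogeneous term of the integral equation for the transformation kernel. -/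
noncomputable def kernelZero (q : ℝ → ℂ) (h : ℂ) (x v : ℝ) : ℂ :=
  spread (Measure.dirac ()) (fun _ => h / 2) (fun _ => 0) (fun _ => 0) x v +
    (spread volume (fun s => q s / 4) id id x v + spread volume (fun s => q s / 4) id Neg.neg x v)

/-- The integral operator of the integral equation for the transformation kernel. -/
noncomputable def kernelOp (q : ℝ → ℂ) (k : ℝ → ℝ → ℂ) (x v : ℝ) : ℂ :=
  spread (volume.prod volume) (fun ω : ℝ × ℝ => q ω.1 * k ω.1 ω.2 / 2) Prod.fst Prod.snd x v

/-- The Picard iterates of the integral equation for the transformation kernel. -/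
noncomputable def kernelIter (q : ℝ → ℂ) (h : ℂ) (n : ℕ) : ℝ → ℝ → ℂ :=
  (kernelOp q)^[n] (kernelZero q h)

/-- The transformation kernel. -/
noncomputable def kernel (q : ℝ → ℂ) (h : ℂ) (x v : ℝ) : ℂ := ∑' n, kernelIter q h n x v

/-- The assumptions on the potential, extended by zero from `(0, d]`. -/
structure Potential (d : ℝ) (q : ℝ → ℂ) : Prop where
  measurable : Measurable q
  integrable : Integrable q
  integrable_sq : Integrable fun s => ‖q s‖ ^ 2
  support : ∀ s, s ∉ Ioc 0 d → q s = 0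

namespace Potential

variable {d : ℝ} {q : ℝ → ℂ} (Q : Potential d q)
include Q

theorem eq_zero_of_lt {s : ℝ} (hs : d < s) : q s = 0 := Q.support s fun h => by linarith [h.2]

theorem abs_le_of_ne_zero {s : ℝ} (hs : q s / 4 ≠ 0) : |s| ≤ s := by
  by_contra h
  refine hs ?_
  rw [Q.support s, zero_div]
  exact fun h' => h (abs_of_pos h'.1).le

theorem measurable_kernelZero (h : ℂ) : Measurable (Function.uncurry (kernelZero q h)) :=
  (measurable_spread measurable_const measurable_const measurable_const).add
    ((measurable_spread (Q.measurable.div_const 4) measurable_id measurable_id).add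
      (measurable_spread (Q.measurable.div_const 4) measurable_id measurable_neg))

theorem kernelZero_support (h : ℂ) {x v : ℝ} (hx : x ≤ |v|) : kernelZero q h x v = 0 := by
  unfold kernelZero
  rw [spread_eq_zero (by simp) hx, spread_eq_zero (f := fun s => q s / 4) (σ := id) (τ := id) (fun s => Q.abs_le_of_ne_zero) hx,
    spread_eq_zero (f := fun s => q s / 4) (σ := id) (τ := Neg.neg)
      (fun s hs => by simpa using Q.abs_le_of_ne_zero hs) hx]
  simp

theorem norm_kernelZero_le (h : ℂ) (x v : ℝ) :
    ‖kernelZero q h x v‖ ≤ ‖h‖ / 2 + (∫ s, ‖q s‖) / 2 := by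
  have hq4 : Integrable fun s => q s / 4 := Q.integrable.div_const 4
  have h0 : ∀ τ : Unit → ℝ, ‖spread (Measure.dirac ()) (fun _ => h / 2) (fun _ => 0) τ x v‖
      ≤ ‖h‖ / 2 := fun τ => by
    refine (norm_spread_le (integrable_const _) measurable_const x v).trans ?_
    refine (setIntegral_le_integral (integrable_const _) (.of_forall fun _ => norm_nonneg _)).trans ?_
    simp
  have h1 : ∀ τ, ‖spread volume (fun s => q s / 4) id τ x v‖ ≤ (∫ s, ‖q s‖) / 4 := fun τ => by
    refine (norm_spread_le hq4 measurable_id x v).trans ?_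
    refine (setIntegral_le_integral hq4.norm (.of_forall fun _ => norm_nonneg _)).trans ?_
    simp [integral_div]
  unfold kernelZero
  refine (norm_add_le _ _).trans ?_
  have h2 := norm_add_le (spread volume (fun s => q s / 4) id id x v)
    (spread volume (fun s => q s / 4) id Neg.neg x v)
  linarith [h0 fun _ => 0, h1 id, h1 Neg.neg]

end Potential

/-- A cone kernel with an exponential bound. -/
structure WeightedKernel (α D : ℝ) (k : ℝ → ℝ → ℂ) : Prop where
  measurable : Measurable (Function.uncurry k)
  bound : ∀ x v, ‖k x v‖ ≤ D * Real.exp (α * x)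
  support : ∀ x v, x ≤ |v| → k x v = 0

namespace WeightedKernel

variable {α D d : ℝ} {k : ℝ → ℝ → ℂ} {q : ℝ → ℂ}

theorem nonneg (H : WeightedKernel α D k) : 0 ≤ D := by
  simpa using (norm_nonneg _).trans (H.bound 0 0)

theorem coneKernel (H : WeightedKernel α D k) (hα : 0 < α) (d : ℝ) :
    ConeKernel d (D * Real.exp (α * d)) k :=
  ⟨H.measurable, fun x hx v => (H.bound x v).trans
    (by have := H.nonneg; gcongr), H.support⟩

/-- The source `q(s) k(s, u) / 2` lives on `s ≤ d`, `|u| ≤ d`. Integration over `u` costs `2 d`, and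
the weight supplies `1 / (2 (d + 1))`, so the constant `D` is at least halved. -/
theorem integral_norm_le (H : WeightedKernel α D k) (hα : 0 < α) (Q : Potential d q)
    (hd : 0 ≤ d)
    (hw : ∀ x, ∫ s in Iio x, ‖q s‖ * Real.exp (α * s) ≤ 1 / (2 * (d + 1)) * Real.exp (α * x))
    (x : ℝ) :
    ∫ ω : ℝ × ℝ in {ω | ω.1 < x}, ‖q ω.1 * k ω.1 ω.2 / 2‖ ∂(volume.prod volume) ≤
      D / 2 * Real.exp (α * x) := by
  have hD := H.nonneg
  have hm : MeasurableSet {ω : ℝ × ℝ | ω.1 < x} := measurableSet_lt measurable_fst measurable_const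
  have hqe : Integrable fun s => ‖q s‖ * Real.exp (α * s) := by
    refine (Q.integrable.norm.mul_const (Real.exp (α * d))).mono'
      (Q.measurable.norm.mul (by fun_prop)).aestronglyMeasurable (.of_forall fun s => ?_)
    rw [norm_mul, norm_norm, Real.norm_eq_abs, Real.abs_exp]
    by_cases hs : s ≤ d
    · gcongr
    · simp [Q.eq_zero_of_lt (not_le.1 hs)]
  have hi : Integrable (indicator (Iio x) fun s => ‖q s‖ * Real.exp (α * s)) :=
    hqe.indicator measurableSet_Iio
  have hi2 := ConeKernel.integrable_indicator_const d (D / 2)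
  rw [← integral_indicator hm]
  calc ∫ ω : ℝ × ℝ, indicator {ω : ℝ × ℝ | ω.1 < x} (fun ω => ‖q ω.1 * k ω.1 ω.2 / 2‖) ω
        ∂(volume.prod volume)
      ≤ ∫ ω : ℝ × ℝ, indicator (Iio x) (fun s => ‖q s‖ * Real.exp (α * s)) ω.1 *
          indicator (Icc (-d) d) (fun _ => D / 2) ω.2 ∂(volume.prod volume) := by
        refine integral_mono_of_nonneg
          (.of_forall fun _ => indicator_nonneg (fun _ _ => norm_nonneg _) _)
          (hi.mul_prod hi2) (.of_forall fun ω => ?_)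
        simp only
        by_cases hx : ω.1 < x
        · rw [indicator_of_mem (show ω ∈ {ω : ℝ × ℝ | ω.1 < x} from hx),
            indicator_of_mem (show ω.1 ∈ Iio x from hx)]
          by_cases hs : ω.1 ≤ d
          · by_cases hv : ω.2 ∈ Icc (-d) d
            · rw [indicator_of_mem hv, norm_div, norm_mul]
              have := H.bound ω.1 ω.2
              calc ‖q ω.1‖ * ‖k ω.1 ω.2‖ / ‖(2 : ℂ)‖
                  ≤ ‖q ω.1‖ * (D * Real.exp (α * ω.1)) / ‖(2 : ℂ)‖ := by gcongr
                _ = _ := by rw [Complex.norm_two]; ring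
            · rw [indicator_of_notMem hv, H.support _ _ ?_]
              · simp
              · by_contra h
                exact hv (abs_le.1 (by linarith))
          · simp [Q.eq_zero_of_lt (not_le.1 hs)]
        · rw [indicator_of_notMem (show ω ∉ {ω : ℝ × ℝ | ω.1 < x} from hx),
            indicator_of_notMem (show ω.1 ∉ Iio x from hx), zero_mul]
    _ = (∫ s in Iio x, ‖q s‖ * Real.exp (α * s)) * (2 * d * (D / 2)) := by
        rw [integral_prod_mul, integral_indicator measurableSet_Iio,
          integral_indicator measurableSet_Icc, setIntegral_const]
        simp only [Measure.real, Real.volume_Icc, smul_eq_mul]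
        rw [ENNReal.toReal_ofReal (by linarith)]
        ring
    _ ≤ (1 / (2 * (d + 1)) * Real.exp (α * x)) * (2 * d * (D / 2)) := by
        gcongr; exact hw x
    _ = (d / (d + 1)) * (D / 2 * Real.exp (α * x)) := by field_simp
    _ ≤ 1 * (D / 2 * Real.exp (α * x)) := by
        gcongr
        rw [div_le_one (by positivity)]; linarith
    _ = _ := one_mul _

theorem measurable_mul (H : WeightedKernel α D k) (Q : Potential d q) :
    Measurable fun ω : ℝ × ℝ => q ω.1 * k ω.1 ω.2 / 2 :=
  ((Q.measurable.comp measurable_fst).mul H.measurable).div_const 2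

theorem integrable_mul (H : WeightedKernel α D k) (hα : 0 < α) (Q : Potential d q) :
    Integrable (fun ω : ℝ × ℝ => q ω.1 * k ω.1 ω.2 / 2) (volume.prod volume) :=
  (H.coneKernel hα d).integrable_weight_mul Q.measurable Q.integrable fun _ => Q.eq_zero_of_lt

theorem abs_le_of_ne_zero (H : WeightedKernel α D k) (ω : ℝ × ℝ)
    (hω : q ω.1 * k ω.1 ω.2 / 2 ≠ 0) : |ω.2| ≤ ω.1 := by
  by_contra h
  exact hω (by rw [H.support _ _ (not_le.1 h).le]; simp)

theorem kernelOp (H : WeightedKernel α D k) (hα : 0 < α) (Q : Potential d q) (hd : 0 ≤ d)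
    (hw : ∀ x, ∫ s in Iio x, ‖q s‖ * Real.exp (α * s) ≤ 1 / (2 * (d + 1)) * Real.exp (α * x)) :
    WeightedKernel α (D / 2) (kernelOp q k) where
  measurable := measurable_spread (H.measurable_mul Q) measurable_fst measurable_snd
  bound x v := (norm_spread_le (H.integrable_mul hα Q) measurable_fst x v).trans
    (H.integral_norm_le hα Q hd hw x)
  support _ _ hx := spread_eq_zero H.abs_le_of_ne_zero hx

end WeightedKernel

namespace Potential

variable {d : ℝ} {q : ℝ → ℂ}

theorem weightedKernel_iter (Q : Potential d q) (hd : 0 ≤ d) (h : ℂ) {α : ℝ} (hα : 0 < α)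
    (hw : ∀ x, ∫ s in Iio x, ‖q s‖ * Real.exp (α * s) ≤ 1 / (2 * (d + 1)) * Real.exp (α * x))
    (n : ℕ) :
    WeightedKernel α ((‖h‖ / 2 + (∫ s, ‖q s‖) / 2) * (1 / 2) ^ n) (kernelIter q h n) := by
  induction n with
  | zero =>
    refine ⟨Q.measurable_kernelZero h, fun x v => ?_, fun _ _ => Q.kernelZero_support h⟩
    have hI : 0 ≤ ∫ s, ‖q s‖ := integral_nonneg fun _ => norm_nonneg _
    have hD : 0 ≤ ‖h‖ / 2 + (∫ s, ‖q s‖) / 2 := by positivity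
    rw [pow_zero, mul_one]
    by_cases hx : x ≤ 0
    · rw [kernelIter, Function.iterate_zero, id, Q.kernelZero_support h (hx.trans (abs_nonneg v)),
        norm_zero]
      positivity
    · refine (Q.norm_kernelZero_le h x v).trans (le_mul_of_one_le_right hD ?_)
      exact Real.one_le_exp (mul_nonneg hα.le (not_le.1 hx).le)
  | succ n ih =>
    have := ih.kernelOp hα Q hd hw
    rw [kernelIter, Function.iterate_succ_apply', pow_succ, ← mul_assoc, mul_one_div]
    exact this

/-- The Picard series is dominated by a geometric series of ratio `1 / 2` in the weighted norm, so
it converges and may be integrated termwise; shifting the index gives the fixed point equation. -/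
theorem exists_weighted_kernel (Q : Potential d q) (hd : 0 ≤ d) (h : ℂ) :
    ∃ α D : ℝ, 0 < α ∧ WeightedKernel α D (kernel q h) ∧
      ∀ x v, kernel q h x v = kernelZero q h x v + kernelOp q (kernel q h) x v := by
  obtain ⟨α, hα, hw⟩ := exists_weight Q.integrable_sq (ε := 1 / (2 * (d + 1))) (by positivity)
  set D := ‖h‖ / 2 + (∫ s, ‖q s‖) / 2
  have W := Q.weightedKernel_iter hd h hα hw
  have hgeo : HasSum (fun n : ℕ => (1 / 2 : ℝ) ^ n) 2 := hasSum_geometric_two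
  have hsum : ∀ x, HasSum (fun n : ℕ => D * (1 / 2 : ℝ) ^ n * Real.exp (α * x))
      (D * 2 * Real.exp (α * x)) := fun x => (hgeo.mul_left D).mul_right _
  have hs : ∀ x v, Summable fun n => kernelIter q h n x v := fun x v =>
    Summable.of_norm_bounded (hsum x).summable fun n => (W n).bound x v
  have hrec : ∀ n, kernelIter q h (n + 1) = kernelOp q (kernelIter q h n) := fun n =>
    Function.iterate_succ_apply' _ _ _
  refine ⟨α, D * 2, hα, ⟨?_, fun x v => ?_, fun x v hx => ?_⟩, fun x v => ?_⟩
  · refine measurable_of_tendsto_metrizable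
      (f := fun N (z : ℝ × ℝ) => ∑ n ∈ Finset.range N, kernelIter q h n z.1 z.2)
      (fun N => Finset.measurable_fun_sum _ fun n _ => (W n).measurable) ?_
    exact tendsto_pi_nhds.2 fun z => (hs z.1 z.2).hasSum.tendsto_sum_nat
  · exact tsum_of_norm_bounded (hsum x) fun n => (W n).bound x v
  · simp only [kernel, (W _).support x v hx, tsum_zero]
  · rw [kernel, (hs x v).tsum_eq_zero_add]
    congr 1
    simp only [hrec]
    have hint : ∀ n, Integrable (fun ω : ℝ × ℝ => if |v - ω.2| < x - ω.1 then
        q ω.1 * kernelIter q h n ω.1 ω.2 / 2 else 0) (volume.prod volume) := by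
      intro n
      have hm : MeasurableSet {ω : ℝ × ℝ | |v - ω.2| < x - ω.1} :=
        measurableSet_lt (measurable_const.sub measurable_snd).abs
          (measurable_const.sub measurable_fst)
      exact ((W n).integrable_mul hα Q).indicator hm
    have hsn : Summable fun n => ∫ ω : ℝ × ℝ, ‖(if |v - ω.2| < x - ω.1 then
        q ω.1 * kernelIter q h n ω.1 ω.2 / 2 else 0)‖ ∂(volume.prod volume) := by
      refine Summable.of_nonneg_of_le (fun n => integral_nonneg fun _ => norm_nonneg _)
        (fun n => ?_) ((hsum x).summable.div_const 2)
      refine (integral_norm_spread_le ((W n).integrable_mul hα Q) measurable_fst x v).trans ?_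
      refine ((W n).integral_norm_le hα Q hd hw x).trans (le_of_eq ?_)
      ring
    have := (hasSum_integral_of_summable_integral_norm hint hsn).tsum_eq
    refine this.trans ?_
    refine integral_congr_ae (.of_forall fun ω => ?_)
    simp only
    split_ifs
    · rw [kernel, ← tsum_mul_left, ← tsum_div_const]
    · simp

end Potential

/-! ### The normalized solution represented by its transformation kernel. -/

theorem measurable_sinDivPos (l : ℂ) : Measurable (sinDivPos l) :=
  Measurable.ite measurableSet_Ioi (continuous_sinDiv l).measurable measurable_const

theorem exists_bound_sinDivPos (l : ℂ) (a b : ℝ) :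
    ∃ M, ∀ r ∈ Icc a b, ‖sinDivPos l r‖ ≤ M := by
  obtain ⟨M, hM⟩ := (isCompact_Icc (a := a) (b := b)).exists_bound_of_continuousOn
    (continuous_sinDiv l).continuousOn
  refine ⟨|M|, fun r hr => ?_⟩
  unfold sinDivPos
  split_ifs
  · exact (hM r hr).trans (le_abs_self M)
  · simp

theorem ConeKernel.mul_wave {d C : ℝ} {k : ℝ → ℝ → ℂ} (H : ConeKernel d C k) (l : ℂ) :
    ∃ C', ConeKernel d C' fun x v => k x v * wave l v := by
  obtain ⟨M, hM⟩ := (isCompact_Icc (a := -d) (b := d)).exists_bound_of_continuousOn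
    (continuous_wave l).continuousOn
  refine ⟨C * |M|, H.measurable.mul ((continuous_wave l).measurable.comp measurable_snd),
    fun x hx v => ?_, fun x v hx => by rw [H.support x v hx, zero_mul]⟩
  have hC := H.nonneg
  have h := H.norm_mul_wave_le hM hx v
  by_cases hv : v ∈ Icc (-d) d
  · rw [indicator_of_mem hv] at h
    exact h.trans (mul_le_mul_of_nonneg_left (le_abs_self M) hC)
  · rw [indicator_of_notMem hv] at h
    exact h.trans (mul_nonneg hC (abs_nonneg M))

/-- The solution of `-y'' + q y = l² y`, `y 0 = 1`, `y' 0 = h`, through its transformation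
kernel. -/
noncomputable def phi (q : ℝ → ℂ) (h l : ℂ) (x : ℝ) : ℂ :=
  Complex.cos (l * x) + ∫ v, kernel q h x v * wave l v

namespace Potential

variable {d : ℝ} {q : ℝ → ℂ}

theorem mem_of_ne_zero (Q : Potential d q) {s : ℝ} (hs : q s ≠ 0) : s ∈ Ioc 0 d := by
  by_contra h
  exact hs (Q.support s h)

theorem integrable_mul (Q : Potential d q) {g : ℝ → ℂ} (hg : Measurable g) {M : ℝ}
    (hM : ∀ s ∈ Ioc 0 d, ‖g s‖ ≤ M) : Integrable fun s => q s * g s := by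
  refine (Q.integrable.norm.mul_const M).mono' (Q.measurable.mul hg).aestronglyMeasurable
    (.of_forall fun s => ?_)
  rw [norm_mul]
  by_cases hs : q s = 0
  · simp [hs]
  · gcongr
    exact hM s (Q.mem_of_ne_zero hs)

theorem exists_coneKernel (Q : Potential d q) (hd : 0 ≤ d) (h : ℂ) :
    ∃ C, ConeKernel d C (kernel q h) := by
  obtain ⟨α, D, hα, W, -⟩ := Q.exists_weighted_kernel hd h
  exact ⟨_, W.coneKernel hα d⟩

theorem measurable_phi (Q : Potential d q) (hd : 0 ≤ d) (h l : ℂ) : Measurable (phi q h l) := by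
  obtain ⟨C, hC⟩ := Q.exists_coneKernel hd h
  exact (by fun_prop : Measurable fun x : ℝ => Complex.cos (l * x)).add (hC.measurable_transform l)

theorem exists_bound_phi (Q : Potential d q) (hd : 0 ≤ d) (h l : ℂ) :
    ∃ M, ∀ x ∈ Icc 0 d, ‖phi q h l x‖ ≤ M := by
  obtain ⟨C, hC⟩ := Q.exists_coneKernel hd h
  obtain ⟨M, hM⟩ := hC.exists_bound_transform l
  obtain ⟨N, hN⟩ := (isCompact_Icc (a := (0 : ℝ)) (b := d)).exists_bound_of_continuousOn
    (f := fun x : ℝ => Complex.cos (l * x)) (by fun_prop)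
  exact ⟨N + M, fun x hx => (norm_add_le _ _).trans (add_le_add (hN x hx) (hM x hx.2))⟩

/-- Explains the constants in `kernelZero`: each box contributes `2 sinDivPos`, turning `h / 2` into
`h`, and the two sources `q / 4` at `± s` combine through `wave l s + wave l (-s) = 2 cos (l s)`
into `q cos (l s)`. -/
theorem integral_kernelZero_mul_wave (Q : Potential d q) (h l : ℂ) {x : ℝ} (hx : 0 ≤ x) :
    Integrable (fun v => kernelZero q h x v * wave l v) ∧
    ∫ v, kernelZero q h x v * wave l v =
      h * sinDiv l x + ∫ s, q s * (sinDivPos l (x - s) * Complex.cos (l * s)) := by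
  have hq4 : Integrable fun s => q s / 4 := Q.integrable.div_const 4
  have hm4 : Measurable fun s => q s / 4 := Q.measurable.div_const 4
  have c0 : ∀ ω : Unit, h / 2 ≠ 0 → |(0 : ℝ)| ≤ 0 := by simp
  have c1 : ∀ s : ℝ, q s / 4 ≠ 0 → |id s| ≤ id s := fun s => Q.abs_le_of_ne_zero
  have c2 : ∀ s : ℝ, q s / 4 ≠ 0 → |Neg.neg s| ≤ id s :=
    fun s hs => by simpa using Q.abs_le_of_ne_zero hs
  have i0 := integrable_spread_mul_wave (μ := Measure.dirac ()) measurable_const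
    (integrable_const (h / 2)) measurable_const measurable_const c0 x l
  have i1 := integrable_spread_mul_wave hm4 hq4 measurable_id measurable_id c1 x l
  have i2 := integrable_spread_mul_wave hm4 hq4 measurable_id measurable_neg c2 x l
  have e0 := integral_spread_mul_wave (μ := Measure.dirac ()) measurable_const
    (integrable_const (h / 2)) measurable_const measurable_const c0 x l
  have e1 := integral_spread_mul_wave hm4 hq4 measurable_id measurable_id c1 x l
  have e2 := integral_spread_mul_wave hm4 hq4 measurable_id measurable_neg c2 x l
  have i12 : Integrable fun v => spread volume (fun s => q s / 4) id id x v * wave l v +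
      spread volume (fun s => q s / 4) id Neg.neg x v * wave l v := i1.add i2
  simp only [kernelZero, add_mul]
  refine ⟨i0.add i12, ?_⟩
  rw [integral_add i0 i12, integral_add i1 i2, e0, e1, e2]
  congr 1
  · simp [wave, sinDivPos_of_nonneg l hx]
    ring
  · obtain ⟨M, hM⟩ := exists_bound_sinDivPos l (x - d) x
    have key : ∀ τ : ℝ → ℝ, Continuous τ →
        Integrable fun s => q s / 4 * (2 * sinDivPos l (x - id s) * wave l (τ s)) := by
      intro τ hτ
      obtain ⟨N, hN⟩ := (isCompact_Icc (a := (0 : ℝ)) (b := d)).exists_bound_of_continuousOn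
        ((continuous_wave l).comp hτ).continuousOn
      have := Q.integrable_mul (g := fun s => (1 / 4) * (2 * sinDivPos l (x - s) * wave l (τ s)))
        (M := 1 / 4 * (2 * M * N))
        (measurable_const.mul ((measurable_const.mul ((measurable_sinDivPos l).comp
          (measurable_const.sub measurable_id))).mul ((continuous_wave l).comp hτ).measurable)) ?_
      · refine this.congr (.of_forall fun s => ?_)
        simp only [id]; ring
      · intro s hs
        have h1 := hM (x - s) ⟨by linarith [hs.2], by linarith [hs.1]⟩
        have h2 := hN s (Ioc_subset_Icc_self hs)
        have h3 : 0 ≤ M := (norm_nonneg _).trans h1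
        rw [norm_mul, norm_mul, norm_mul]
        have : ‖(1 / 4 : ℂ)‖ = 1 / 4 := by norm_num
        rw [this, Complex.norm_two]
        gcongr
        exact h2
    rw [← integral_add (key id continuous_id) (key Neg.neg continuous_neg)]
    refine integral_congr_ae (.of_forall fun s => ?_)
    have := wave_add_wave_neg l s
    simp only [id]
    linear_combination (q s / 2 * sinDivPos l (x - s)) * this

/-- This is the Fourier integral in `v` of the fixed point equation for `kernel`: the inhomogeneous
term accounts for the cosine part of `phi` under the integral, and `kernelOp` for the rest. -/
theorem phi_eq_volterra (Q : Potential d q) (hd : 0 ≤ d) (h l : ℂ) {x : ℝ} (hx : x ∈ Icc 0 d) :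
    phi q h l x = Complex.cos (l * x) + h * sinDiv l x +
      ∫ s in Ioc 0 x, sinDiv l (x - s) * q s * phi q h l s := by
  obtain ⟨α, D, hα, W, hrec⟩ := Q.exists_weighted_kernel hd h
  have K := W.coneKernel hα d
  obtain ⟨i0, e0⟩ := Q.integral_kernelZero_mul_wave h l hx.1
  have i1 := integrable_spread_mul_wave (W.measurable_mul Q) (W.integrable_mul hα Q)
    measurable_fst measurable_snd W.abs_le_of_ne_zero x l
  have e1 := integral_spread_mul_wave (W.measurable_mul Q) (W.integrable_mul hα Q)
    measurable_fst measurable_snd W.abs_le_of_ne_zero x l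
  obtain ⟨M, hM⟩ := exists_bound_sinDivPos l (x - d) x
  obtain ⟨N, hN⟩ := (isCompact_Icc (a := (0 : ℝ)) (b := d)).exists_bound_of_continuousOn
    (f := fun x : ℝ => Complex.cos (l * x)) (by fun_prop)
  obtain ⟨P, hP⟩ := K.exists_bound_transform l
  have mS : Measurable fun s => sinDivPos l (x - s) :=
    (measurable_sinDivPos l).comp (measurable_const.sub measurable_id)
  have bS : ∀ s ∈ Ioc 0 d, ‖sinDivPos l (x - s)‖ ≤ M := fun s hs =>
    hM (x - s) ⟨by linarith [hs.2], by linarith [hs.1]⟩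
  have hmul : ∀ {g : ℝ → ℂ} {R : ℝ}, Measurable g → (∀ s ∈ Icc 0 d, ‖g s‖ ≤ R) →
      Integrable fun s => q s * (sinDivPos l (x - s) * g s) := by
    intro g R hg hR
    refine Q.integrable_mul (mS.mul hg) (M := M * R) fun s hs => ?_
    rw [norm_mul]
    exact mul_le_mul (bS s hs) (hR s (Ioc_subset_Icc_self hs)) (norm_nonneg _)
      ((norm_nonneg _).trans (bS s hs))
  have e2 : ∫ ω : ℝ × ℝ, q ω.1 * kernel q h ω.1 ω.2 / 2 *
        (2 * sinDivPos l (x - ω.1) * wave l ω.2) ∂(volume.prod volume) =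
      ∫ s, q s * (sinDivPos l (x - s) * ∫ v, kernel q h s v * wave l v) := by
    -- For Fubini, the wave is absorbed into the cone kernel and `2 sinDivPos l (x - s)` into the
    -- potential.
    obtain ⟨C', K'⟩ := K.mul_wave l
    have hw : Integrable fun s => q s * (2 * sinDivPos l (x - s)) :=
      Q.integrable_mul (measurable_const.mul mS) (M := 2 * M) fun s hs => by
        rw [norm_mul, Complex.norm_two]; gcongr; exact bS s hs
    have hi := K'.integrable_weight_mul (Q.measurable.mul (measurable_const.mul mS)) hw
      fun s hs => by simp [Q.eq_zero_of_lt hs]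
    have : ∀ ω : ℝ × ℝ, q ω.1 * kernel q h ω.1 ω.2 / 2 *
        (2 * sinDivPos l (x - ω.1) * wave l ω.2) =
        q ω.1 * (2 * sinDivPos l (x - ω.1)) * (kernel q h ω.1 ω.2 * wave l ω.2) / 2 :=
      fun ω => by ring
    simp only [this]
    refine (integral_prod _ hi).trans ?_
    refine integral_congr_ae (.of_forall fun s => ?_)
    simp only [integral_const_mul, integral_div, Pi.mul_apply]
    ring
  have e3 : ∫ v, kernel q h x v * wave l v = h * sinDiv l x +
      ∫ s, q s * (sinDivPos l (x - s) * phi q h l s) := by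
    simp only [hrec x, add_mul]
    refine (integral_add i0 i1).trans ?_
    rw [e0, e1, e2, add_assoc, ← integral_add
      (hmul (by fun_prop) hN) (hmul (K.measurable_transform l) fun s hs => hP s hs.2)]
    congr 1
    refine integral_congr_ae (.of_forall fun s => ?_)
    simp only [phi]
    ring
  have e4 : ∫ s, q s * (sinDivPos l (x - s) * phi q h l s) =
      ∫ s in Ioc 0 x, sinDiv l (x - s) * q s * phi q h l s := by
    rw [← setIntegral_eq_integral_of_forall_compl_eq_zero (s := Ioc 0 x)]
    · refine setIntegral_congr_fun measurableSet_Ioc fun s hs => ?_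
      rw [sinDivPos_of_nonneg l (by linarith [hs.2])]
      ring
    · intro s hs
      by_cases h0 : q s = 0
      · simp [h0]
      · have hs' := Q.mem_of_ne_zero h0
        have : ¬ 0 < x - s := fun h => hs ⟨hs'.1, by linarith⟩
        simp [sinDivPos, this]
  rw [← e4, add_assoc, ← e3, phi]

end Potential

/-- A solution with `y' 0 = h y 0` is a multiple of `phi`. -/
theorem IsSolution.eq_mul_phi {d : ℝ} {q : ℝ → ℝ} {h l : ℂ} {y p : ℝ → ℂ}
    (Q : Potential d fun s => (q s : ℂ)) (hd : 0 ≤ d) (H : IsSolution d q (l ^ 2) y p)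
    (hp : p 0 = h * y 0) :
    ∀ x ∈ Icc 0 d, y x = y 0 * phi (fun s => (q s : ℂ)) h l x := by
  have hq : IntegrableOn q (Ioc 0 d) := by
    have := Q.integrable.re
    simpa using this.integrableOn (s := Ioc 0 d)
  obtain ⟨M, hM⟩ := isCompact_Icc.exists_bound_of_continuousOn H.continuousOn
  obtain ⟨N, hN⟩ := Q.exists_bound_phi hd h l
  obtain ⟨C, hC⟩ := (isCompact_Icc (a := (0 : ℝ)) (b := d)).exists_bound_of_continuousOn
    (continuous_sinDiv l).continuousOn
  -- Uniqueness is applied to the integral equations, so no differentiability of `phi` is needed: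
  -- the free terms cancel because `p 0 = h * y 0`.
  have key := eq_zero_of_volterra Q.integrable Q.integrable_sq
    (u := fun x => y x - y 0 * phi (fun s => (q s : ℂ)) h l x) (b := d) (abs_nonneg C)
    (M := M + ‖y 0‖ * N) ?_ ?_
  · exact fun x hx => sub_eq_zero.1 (key x hx)
  · intro x hx
    refine (norm_sub_le _ _).trans ?_
    rw [norm_mul]
    gcongr
    · exact hM x hx
    · exact hN x hx
  · intro x hx
    have cS : Continuous fun s => sinDiv l (x - s) := (continuous_sinDiv l).comp (by fun_prop)
    have hsub : Icc 0 x ⊆ Icc 0 d := Icc_subset_Icc_right hx.2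
    have j1 : IntegrableOn (fun s => (q s : ℂ) * y s) (Ioc 0 x) :=
      ((Q.integrable.integrableOn (s := Icc 0 x)).mul_continuousOn (H.continuousOn.mono hsub)
        isCompact_Icc).mono_set Ioc_subset_Icc_self
    have j2 : IntegrableOn (fun s => (q s : ℂ) * phi (fun s => (q s : ℂ)) h l s) (Ioc 0 x) :=
      (Q.integrable_mul (Q.measurable_phi hd h l)
        fun s hs => hN s (Ioc_subset_Icc_self hs)).integrableOn
    have cont : ∀ {g : ℝ → ℂ}, IntegrableOn g (Ioc 0 x) →
        IntegrableOn (fun s => sinDiv l (x - s) * g s) (Ioc 0 x) := fun hg => by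
      rw [← integrableOn_Icc_iff_integrableOn_Ioc] at hg ⊢
      exact hg.continuousOn_mul cS.continuousOn isCompact_Icc
    have e : y x - y 0 * phi (fun s => (q s : ℂ)) h l x =
        ∫ s in Ioc 0 x, (sinDiv l (x - s) * ((q s : ℂ) * y s) -
          y 0 * (sinDiv l (x - s) * ((q s : ℂ) * phi (fun s => (q s : ℂ)) h l s))) := by
      rw [integral_sub (cont j1) ((cont j2).const_mul _), integral_const_mul,
        Q.phi_eq_volterra hd h l hx, H.eq_volterra hq x hx, hp]
      simp only [mul_assoc]
      ring
    rw [e, ← integral_const_mul]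
    refine norm_integral_le_of_norm_le ?_ ?_
    · refine Integrable.const_mul ?_ _
      refine (j1.sub (j2.const_mul (y 0))).norm.congr (.of_forall fun s => ?_)
      simp only [Pi.sub_apply]
      rw [← norm_mul]
      congr 1
      ring
    · filter_upwards [ae_restrict_mem measurableSet_Ioc] with s hs
      have : sinDiv l (x - s) * ((q s : ℂ) * y s) -
          y 0 * (sinDiv l (x - s) * ((q s : ℂ) * phi (fun s => (q s : ℂ)) h l s)) =
          sinDiv l (x - s) * (q s * (y s - y 0 * phi (fun s => (q s : ℂ)) h l s)) := by ring
      rw [this, norm_mul, norm_mul]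
      gcongr
      exact (hC _ ⟨by linarith [hs.2], by linarith [hs.1, hx.2]⟩).trans (le_abs_self C)

/-! ### Products of two normalized solutions. -/

/-- The kernel at `y = 2 x` of the product of two functions `cos (l x) + ∫ k x v exp (i l v)`. -/
noncomputable def prodKernel (k k' : ℝ → ℝ → ℂ) (y v : ℝ) : ℂ :=
  (k (y / 2) (v - y / 2) + k (y / 2) (v + y / 2)) / 2 +
    (k' (y / 2) (v - y / 2) + k' (y / 2) (v + y / 2)) / 2 +
    ∫ u, k (y / 2) u * k' (y / 2) (v - u)

namespace ConeKernel

variable {d C C' : ℝ} {k k' : ℝ → ℝ → ℂ}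

/-- Shifting by `± x` or convolving two functions supported in `|v| < x` keeps the support in `|v| <
2 x`, which is why the first variable is doubled. The term `2 * d * (C * C')` bounds the convolution
over `[-d, d]`. -/
theorem prod (H : ConeKernel d C k) (H' : ConeKernel d C' k') (hd : 0 ≤ d) :
    ConeKernel (2 * d) (C + C' + 2 * d * (C * C')) (prodKernel k k') where
  measurable := by
    have m : ∀ {k : ℝ → ℝ → ℂ}, Measurable (Function.uncurry k) → Measurable fun z : ℝ × ℝ =>
        (k (z.1 / 2) (z.2 - z.1 / 2) + k (z.1 / 2) (z.2 + z.1 / 2)) / 2 := fun hk =>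
      ((hk.comp (f := fun z : ℝ × ℝ => (z.1 / 2, z.2 - z.1 / 2)) (by fun_prop)).add
        (hk.comp (f := fun z : ℝ × ℝ => (z.1 / 2, z.2 + z.1 / 2)) (by fun_prop))).div_const 2
    have mc : Measurable fun z : (ℝ × ℝ) × ℝ => k (z.1.1 / 2) z.2 * k' (z.1.1 / 2) (z.1.2 - z.2) :=
      (H.measurable.comp (f := fun z : (ℝ × ℝ) × ℝ => (z.1.1 / 2, z.2)) (by fun_prop)).mul
        (H'.measurable.comp (f := fun z : (ℝ × ℝ) × ℝ => (z.1.1 / 2, z.1.2 - z.2)) (by fun_prop))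
    exact ((m H.measurable).add (m H'.measurable)).add
      mc.stronglyMeasurable.integral_prod_right'.measurable
  bound x hx v := by
    have hx' : x / 2 ≤ d := by linarith
    have b1 : ∀ {k : ℝ → ℝ → ℂ} {C : ℝ}, ConeKernel d C k →
        ‖(k (x / 2) (v - x / 2) + k (x / 2) (v + x / 2)) / 2‖ ≤ C := fun {k C} K => by
      rw [norm_div, Complex.norm_two]
      have := norm_add_le (k (x / 2) (v - x / 2)) (k (x / 2) (v + x / 2))
      have h1 := K.bound _ hx' (v - x / 2)
      have h2 := K.bound _ hx' (v + x / 2)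
      linarith
    have b2 : ‖∫ u, k (x / 2) u * k' (x / 2) (v - u)‖ ≤ 2 * d * (C * C') := by
      refine (norm_integral_le_of_norm_le (integrable_indicator_const d (C * C'))
        (.of_forall fun u => ?_)).trans (le_of_eq ?_)
      · rw [norm_mul]
        have h1 := H.norm_le_indicator hx' u
        have h2 := H'.bound _ hx' (v - u)
        by_cases hu : u ∈ Icc (-d) d
        · rw [indicator_of_mem hu] at h1 ⊢
          exact mul_le_mul h1 h2 (norm_nonneg _) H.nonneg
        · rw [indicator_of_notMem hu] at h1 ⊢
          rw [le_antisymm h1 (norm_nonneg _), zero_mul]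
      · rw [integral_indicator measurableSet_Icc, setIntegral_const]
        simp only [Measure.real, Real.volume_Icc, smul_eq_mul]
        rw [ENNReal.toReal_ofReal (by linarith)]
        ring
    exact (norm_add_le _ _).trans (add_le_add ((norm_add_le _ _).trans
      (add_le_add (b1 H) (b1 H'))) b2)
  support x v hx := by
    have h1 : x / 2 ≤ |v - x / 2| := by
      rcases le_total 0 v with h | h
      · rw [abs_of_nonneg h] at hx
        exact le_trans (by linarith) (le_abs_self _)
      · rw [abs_of_nonpos h] at hx
        rcases le_total 0 x with h' | h'
        · exact le_trans (by linarith) (neg_le_abs _)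
        · exact le_trans (by linarith) (abs_nonneg _)
    have h2 : x / 2 ≤ |v + x / 2| := by
      rcases le_total 0 v with h | h
      · rcases le_total 0 x with h' | h'
        · exact le_trans (by linarith) (le_abs_self _)
        · exact le_trans (by linarith) (abs_nonneg _)
      · rw [abs_of_nonpos h] at hx
        exact le_trans (by linarith) (neg_le_abs _)
    have h3 : ∀ u, k (x / 2) u * k' (x / 2) (v - u) = 0 := by
      intro u
      by_cases hu : x / 2 ≤ |u|
      · rw [H.support _ _ hu, zero_mul]
      · rw [H'.support _ _ ?_, mul_zero]
        have := abs_add_le (v - u) u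
        rw [sub_add_cancel] at this
        linarith
    simp [prodKernel, H.support _ _ h1, H.support _ _ h2, H'.support _ _ h1, H'.support _ _ h2, h3]

theorem cos_mul_transform (H : ConeKernel d C k) (l : ℂ) {x : ℝ} (hx : x ≤ d) :
    (Integrable fun v => (k x (v - x) + k x (v + x)) / 2 * wave l v) ∧
    ∫ v, (k x (v - x) + k x (v + x)) / 2 * wave l v =
      Complex.cos (l * x) * ∫ v, k x v * wave l v := by
  have hi := H.integrable_mul_wave l hx
  have i1 : Integrable fun v => k x (v - x) * wave l v :=
    ((hi.comp_sub_right x).mul_const (wave l x)).congr (.of_forall fun v => by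
      simp only
      rw [mul_assoc, ← wave_add, sub_add_cancel])
  have i2 : Integrable fun v => k x (v + x) * wave l v :=
    ((hi.comp_add_right x).mul_const (wave l (-x))).congr (.of_forall fun v => by
      simp only
      rw [mul_assoc, ← wave_add, add_neg_cancel_right])
  have e1 : ∫ v, k x (v - x) * wave l v = (∫ v, k x v * wave l v) * wave l x := by
    rw [← integral_mul_const, ← integral_sub_right_eq_self (fun v => k x v * wave l v * wave l x) x]
    refine integral_congr_ae (.of_forall fun v => ?_)
    simp only
    rw [mul_assoc, ← wave_add, sub_add_cancel]
  have e2 : ∫ v, k x (v + x) * wave l v = (∫ v, k x v * wave l v) * wave l (-x) := by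
    rw [← integral_mul_const,
      ← integral_add_right_eq_self (fun v => k x v * wave l v * wave l (-x)) x]
    refine integral_congr_ae (.of_forall fun v => ?_)
    simp only
    rw [mul_assoc, ← wave_add, add_neg_cancel_right]
  have e : ∀ v, (k x (v - x) + k x (v + x)) / 2 * wave l v =
      (k x (v - x) * wave l v + k x (v + x) * wave l v) / 2 := fun v => by ring
  simp only [e]
  refine ⟨(i1.add i2).div_const 2, ?_⟩
  rw [integral_div, integral_add i1 i2, e1, e2]
  have := wave_add_wave_neg l x
  linear_combination (∫ v, k x v * wave l v) / 2 * this

theorem convolution_transform (H : ConeKernel d C k) (H' : ConeKernel d C' k') (l : ℂ) {x : ℝ}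
    (hx : x ≤ d) :
    (Integrable fun v => (∫ u, k x u * k' x (v - u)) * wave l v) ∧
    ∫ v, (∫ u, k x u * k' x (v - u)) * wave l v =
      (∫ v, k x v * wave l v) * ∫ v, k' x v * wave l v := by
  have h := (H.integrable_mul_wave l hx).convolution_integrand (ContinuousLinearMap.mul ℂ ℂ)
    (H'.integrable_mul_wave l hx) (μ := volume) (ν := volume)
  have e : ∀ v u, ContinuousLinearMap.mul ℂ ℂ (k x u * wave l u) (k' x (v - u) * wave l (v - u)) =
      k x u * k' x (v - u) * wave l v := fun v u => by
    have : wave l v = wave l u * wave l (v - u) := by rw [← wave_add, add_sub_cancel]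
    rw [this, ContinuousLinearMap.mul_apply']
    ring
  simp only [e] at h
  have c := integral_convolution (ContinuousLinearMap.mul ℂ ℂ) (μ := volume) (ν := volume)
    (H.integrable_mul_wave l hx) (H'.integrable_mul_wave l hx)
  simp only [MeasureTheory.convolution, e, integral_mul_const] at c
  refine ⟨?_, c⟩
  simpa only [integral_mul_const] using h.integral_prod_left

/-- On expanding the product, `cos² ` gives the constant `1 / 2` and the waves at `± 2 x`, the cross
terms are averages of shifts, and the product of transforms is the transform of a convolution. -/
theorem transform_prodKernel (H : ConeKernel d C k) (H' : ConeKernel d C' k') (l : ℂ) {x : ℝ}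
    (hx : x ≤ d) :
    (Complex.cos (l * x) + ∫ v, k x v * wave l v) *
      (Complex.cos (l * x) + ∫ v, k' x v * wave l v) =
    1 / 2 + (wave l (2 * x) + wave l (-(2 * x))) / 4 +
      ∫ v, prodKernel k k' (2 * x) v * wave l v := by
  obtain ⟨i1, e1⟩ := H.cos_mul_transform l hx
  obtain ⟨i2, e2⟩ := H'.cos_mul_transform l hx
  obtain ⟨i3, e3⟩ := H.convolution_transform H' l hx
  have hx2 : 2 * x / 2 = x := by ring
  have i12 : Integrable fun v => (k x (v - x) + k x (v + x)) / 2 * wave l v +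
    (k' x (v - x) + k' x (v + x)) / 2 * wave l v := i1.add i2
  simp only [prodKernel, hx2, add_mul _ _ (wave l _)]
  rw [integral_add i12 i3, integral_add i1 i2, e1, e2, e3, wave_add_wave_neg]
  have : Complex.cos (l * ((2 * x : ℝ) : ℂ)) = 2 * Complex.cos (l * x) ^ 2 - 1 := by
    rw [← Complex.cos_two_mul]; congr 1; push_cast; ring
  rw [this]
  ring

end ConeKernel

/-! ### Backward Grönwall inequality and measurable representatives of potentials. -/

/-- Grönwall's inequality for an integrable function, backwards from the right end point. -/
theorem ae_eq_zero_of_norm_le_integral {P : ℝ → ℂ} {b C : ℝ} (hb : 0 ≤ b) (hC : 0 ≤ C)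
    (hP : Integrable P)
    (h : ∀ᵐ v ∂volume.restrict (Ioc 0 b), ‖P v‖ ≤ C * ∫ y in Ioc v b, ‖P y‖) :
    ∫ v in Ioc 0 b, ‖P v‖ = 0 := by
  have hii : ∀ a c, IntervalIntegrable (fun v => ‖P v‖) volume a c :=
    fun a c => hP.norm.intervalIntegrable
  set U : ℝ → ℝ := fun v => ∫ y in v..b, ‖P y‖ with hU
  have hUc : Continuous U := by
    have : U = fun v => -∫ y in b..v, ‖P y‖ := by
      ext v; exact intervalIntegral.integral_symm _ _
    rw [this]
    exact (intervalIntegral.continuous_primitive hii b).neg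
  have hU0 : ∀ v ≤ b, 0 ≤ U v := fun v hv =>
    intervalIntegral.integral_nonneg hv fun _ _ => norm_nonneg _
  have hq : ∀ c : ℝ, Integrable ((Ioc 0 b).indicator fun _ => c) := fun c =>
    (integrable_indicator_iff measurableSet_Ioc).2 (integrableOn_const (by simp))
  obtain ⟨M, hM⟩ := (isCompact_Icc (a := (0 : ℝ)) (b := b)).exists_bound_of_continuousOn
    (f := fun x => U (b - x)) (hUc.comp (by fun_prop)).continuousOn
  -- The tail integral `U`, read from the right end as `U (b - x)`, satisfies a Volterra inequality
  -- with weight `1`; at `x = b` the conclusion is `U 0 = 0`.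
  have key := eq_zero_of_volterra (q := (Ioc 0 b).indicator fun _ => (1 : ℂ))
    (u := fun x => ((U (b - x) : ℝ) : ℂ)) (b := b) (M := M)
    ((integrable_indicator_iff measurableSet_Ioc).2 (integrableOn_const (by simp)))
    ((hq 1).congr (.of_forall fun s => by
      by_cases hs : s ∈ Ioc 0 b <;> simp [hs])) hC
    (fun x hx => by rw [Complex.norm_real]; exact hM x hx) ?_ b ⟨hb, le_rfl⟩
  · have h0 : U 0 = 0 := by simpa using key
    rw [← intervalIntegral.integral_of_le hb]
    exact h0
  · intro x hx
    rw [Complex.norm_real, Real.norm_of_nonneg (hU0 _ (by linarith [hx.1]))]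
    have e : ∫ s in Ioc 0 x, ‖(Ioc 0 b).indicator (fun _ => (1 : ℂ)) s‖ * ‖((U (b - s) : ℝ) : ℂ)‖ =
        ∫ v in (b - x)..b, U v := by
      have := intervalIntegral.integral_comp_sub_left (f := U) (a := 0) (b := x) b
      rw [sub_zero] at this
      rw [← this, intervalIntegral.integral_of_le hx.1]
      refine setIntegral_congr_fun measurableSet_Ioc fun s hs => ?_
      have hs' : s ∈ Ioc 0 b := ⟨hs.1, hs.2.trans hx.2⟩
      rw [indicator_of_mem hs', Complex.norm_real,
        Real.norm_of_nonneg (hU0 _ (by linarith [hs.1]))]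
      simp
    rw [e, ← intervalIntegral.integral_const_mul]
    refine intervalIntegral.integral_mono_ae_restrict (by linarith [hx.1]) (hii _ _)
      ((hUc.const_mul C).intervalIntegrable _ _) ?_
    rw [← restrict_Ioc_eq_restrict_Icc]
    filter_upwards [ae_restrict_of_ae_restrict_of_subset
      (Ioc_subset_Ioc_left (by linarith [hx.2] : 0 ≤ b - x)) h,
      ae_restrict_mem measurableSet_Ioc] with v hv hvm
    simp only [hU]
    rwa [intervalIntegral.integral_of_le hvm.2]

/-- A measurable representative, extended by zero, lets the kernel constructions integrate over the
whole line; `IsSolution.congr` transfers solutions to it. -/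
theorem exists_potential {d : ℝ} {q : ℝ → ℝ} (hq : MemLp q 2 (volume.restrict (Ioo 0 d))) :
    ∃ r : ℝ → ℝ, (Potential d fun s => (r s : ℂ)) ∧ q =ᵐ[volume.restrict (Ioc 0 d)] r := by
  rw [restrict_Ioo_eq_restrict_Ioc] at hq
  have hm := hq.1.stronglyMeasurable_mk.measurable
  have hae := hq.1.ae_eq_mk
  have hq' := hq.ae_eq hae
  set g := hq.1.mk q
  refine ⟨(Ioc 0 d).indicator g, ⟨?_, ?_, ?_, fun s hs => by simp [hs]⟩, ?_⟩
  · exact Complex.measurable_ofReal.comp (hm.indicator measurableSet_Ioc)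
  · have h1 : IntegrableOn g (Ioc 0 d) := hq'.integrable (by norm_num)
    exact ((integrable_indicator_iff measurableSet_Ioc).2 h1).ofReal
  · have h2 : IntegrableOn (fun s => ‖g s‖ ^ 2) (Ioc 0 d) := hq'.integrable_norm_pow two_ne_zero
    refine ((integrable_indicator_iff measurableSet_Ioc).2 h2).congr (.of_forall fun s => ?_)
    by_cases hs : s ∈ Ioc 0 d <;> simp [hs]
  · filter_upwards [hae, ae_restrict_mem measurableSet_Ioc] with s hs hsm
    rw [hs, indicator_of_mem hsm]

/-! ### Reduction of a common eigenvalue to an identity on the first edge. -/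

/-- The first component of an eigenfunction does not vanish at `0`. -/
theorem left_ne_zero {d : ℝ} (hd : 0 < d) (hd1 : d < 1) {q₁ q₂ : ℝ → ℝ}
    (hq₂ : MemLp q₂ 2 (volume.restrict (Ioc 0 (1 - d))))
    (hq₁ : MemLp q₁ 2 (volume.restrict (Ioc 0 d)))
    {h₁ a₁ a₂ : ℝ} {z : ℂ} {y₁ p₁ y₂ p₂ : ℝ → ℂ}
    (H₁ : IsSolution d q₁ z y₁ p₁) (H₂ : IsSolution (1 - d) q₂ z y₂ p₂)
    (b₁ : p₁ 0 - (h₁ : ℂ) * y₁ 0 = 0) (m₁ : y₂ (1 - d) = (a₁ : ℂ) * y₁ d)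
    (m₂ : p₂ (1 - d) + (a₁ : ℂ)⁻¹ * p₁ d + (a₂ : ℂ) * y₁ d = 0)
    (hne : (∃ x ∈ Icc 0 d, y₁ x ≠ 0) ∨ (∃ x ∈ Icc 0 (1 - d), y₂ x ≠ 0)) : y₁ 0 ≠ 0 := by
  intro h0
  have hp0 : p₁ 0 = 0 := by rw [h0] at b₁; simpa using b₁
  have hz := H₁.eq_zero_of_left hq₁ h0 hp0
  have hyd := hz d ⟨hd.le, le_rfl⟩
  have hpd : p₁ d = 0 := by
    rw [H₁.deriv_eq d ⟨hd.le, le_rfl⟩, hp0, zero_add, intervalIntegral.integral_of_le hd.le]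
    refine setIntegral_eq_zero_of_forall_eq_zero fun t ht => ?_
    rw [hz t (Ioc_subset_Icc_self ht), mul_zero]
  rw [hyd, mul_zero] at m₁
  rw [hyd, hpd, mul_zero, mul_zero, add_zero, add_zero] at m₂
  -- Since `y₁` and its derivative vanish at `d`, matching gives zero Cauchy data for `y₂` at the
  -- junction.
  have hz2 := H₂.eq_zero_of_right (by linarith) hq₂ m₁ m₂
  rcases hne with ⟨x, hx, hxn⟩ | ⟨x, hx, hxn⟩
  · exact hxn (hz x hx)
  · exact hxn (hz2 x hx)

/-- At a common eigenvalue the two boundary forms on the first edge are proportional. -/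
theorem common_eigenvalue_identity {d : ℝ} (hd : 0 < d) (hd1 : d < 1) {q₁ q₁' q₂ r r' : ℝ → ℝ}
    (hq₂ : MemLp q₂ 2 (volume.restrict (Ioc 0 (1 - d))))
    (hq₁ : MemLp q₁ 2 (volume.restrict (Ioc 0 d))) (hq₁' : MemLp q₁' 2 (volume.restrict (Ioc 0 d)))
    (hr : q₁ =ᵐ[volume.restrict (Ioc 0 d)] r) (hr' : q₁' =ᵐ[volume.restrict (Ioc 0 d)] r')
    (R : Potential d fun s => (r s : ℂ)) (R' : Potential d fun s => (r' s : ℂ))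
    {h₁ h₁' h₂ a₁ a₂ : ℝ} (ha₁ : 0 < a₁) {l : ℂ}
    (E : IsEigenvalue d q₁ q₂ h₁ h₂ a₁ a₂ (l ^ 2))
    (E' : IsEigenvalue d q₁' q₂ h₁' h₂ a₁ a₂ (l ^ 2)) :
    ((h₁' : ℂ) - h₁) + ∫ s in (0 : ℝ)..d, ((r' s : ℂ) - r s) *
      (phi (fun s => (r s : ℂ)) h₁ l s * phi (fun s => (r' s : ℂ)) h₁' l s) = 0 := by
  obtain ⟨y₁, p₁, y₂, p₂, H₁, H₂, b₁, b₂, m₁, m₂, hne⟩ := E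
  obtain ⟨y₁', p₁', y₂', p₂', H₁', H₂', b₁', b₂', m₁', m₂', hne'⟩ := E'
  have hy := left_ne_zero hd hd1 hq₂ hq₁ H₁ H₂ b₁ m₁ m₂ hne
  have hy' := left_ne_zero hd hd1 hq₂ hq₁' H₁' H₂' b₁' m₁' m₂' hne'
  have iq₂ : IntegrableOn q₂ (Ioc 0 (1 - d)) := hq₂.integrable (by norm_num)
  have ir : IntegrableOn r (Ioc 0 d) := Integrable.congr (hq₁.integrable (by norm_num)) hr
  have ir' : IntegrableOn r' (Ioc 0 d) := Integrable.congr (hq₁'.integrable (by norm_num)) hr'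
  have W₂ := H₂.wronskian H₂' (by linarith) iq₂ iq₂
  simp only [sub_self, zero_mul, intervalIntegral.integral_zero, add_zero] at W₂
  have K := H₁.congr hr
  have K' := H₁'.congr hr'
  have W₁ := K.wronskian K' hd.le ir ir'
  have hp : p₁ 0 = h₁ * y₁ 0 := sub_eq_zero.1 b₁
  have hp' : p₁' 0 = h₁' * y₁' 0 := sub_eq_zero.1 b₁'
  have ha : (a₁ : ℂ) ≠ 0 := by exact_mod_cast ha₁.ne'
  -- On the second edge the Wronskian is constant, and it is zero at `0` because both solutions
  -- share `h₂`. Under matching it becomes minus the Wronskian on the first edge: `a₁ a₁⁻¹ = 1` and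
  -- the `a₂` terms cancel.
  have W0 : y₁ d * p₁' d - p₁ d * y₁' d = 0 := by
    have e1 : p₂ (1 - d) = -((a₁ : ℂ)⁻¹ * p₁ d) - a₂ * y₁ d := by linear_combination m₂
    have e2 : p₂' (1 - d) = -((a₁ : ℂ)⁻¹ * p₁' d) - a₂ * y₁' d := by linear_combination m₂'
    have e3 : p₂ 0 = h₂ * y₂ 0 := sub_eq_zero.1 b₂
    have e4 : p₂' 0 = h₂ * y₂' 0 := sub_eq_zero.1 b₂'
    rw [m₁, m₁', e1, e2, e3, e4] at W₂
    field_simp at W₂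
    linear_combination -W₂
  have eI : ∫ s in (0 : ℝ)..d, ((r' s : ℂ) - r s) * (y₁ s * y₁' s) =
      y₁ 0 * y₁' 0 * ∫ s in (0 : ℝ)..d, ((r' s : ℂ) - r s) *
        (phi (fun s => (r s : ℂ)) h₁ l s * phi (fun s => (r' s : ℂ)) h₁' l s) := by
    rw [← intervalIntegral.integral_const_mul]
    refine intervalIntegral.integral_congr fun s hs => ?_
    rw [uIcc_of_le hd.le] at hs
    rw [K.eq_mul_phi R hd.le hp s hs, K'.eq_mul_phi R' hd.le hp' s hs]
    ring
  rw [W0, eI, hp, hp'] at W₁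
  have : y₁ 0 * y₁' 0 * (((h₁' : ℂ) - h₁) + ∫ s in (0 : ℝ)..d, ((r' s : ℂ) - r s) *
      (phi (fun s => (r s : ℂ)) h₁ l s * phi (fun s => (r' s : ℂ)) h₁' l s)) = 0 := by
    linear_combination -W₁
  exact (mul_eq_zero.1 this).resolve_left (mul_ne_zero hy hy')

/-! ### Completeness and recovery of the potential from its Fourier density. -/

/-- A square integrable function orthogonal to a complete exponential system vanishes. -/
theorem ae_eq_zero_of_complete {c : ℝ} {I : Set ℕ} {lam : ℕ → ℂ}
    (hI : ExpSystemComplete c I lam) {G : ℝ → ℂ} (hG : MemLp G 2 (symMeasure c))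
    (h : ∀ n ∈ I, ∫ v, G v * wave (lam n) v ∂symMeasure c = 0 ∧
      ∫ v, G v * wave (-lam n) v ∂symMeasure c = 0) : G =ᵐ[symMeasure c] 0 := by
  -- The inner product conjugates its first argument, so the bilinear pairing with `G` is the inner
  -- product with its conjugate.
  have hs : MemLp (fun v => starRingEnd ℂ (G v)) 2 (symMeasure c) := hG.star
  have hin : ∀ m : ℂ, inner ℂ (hs.toLp _) (expL2 c m) = ∫ v, G v * wave m v ∂symMeasure c := by
    intro m
    rw [L2.inner_def]
    refine integral_congr_ae ?_
    filter_upwards [hs.coeFn_toLp, (memLp_exp c m).coeFn_toLp] with v h1 h2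
    rw [expL2, h1, h2]
    simp [wave, mul_comm]
  have hmem : hs.toLp _ ∈ (Submodule.span ℂ {f : Lp ℂ 2 (symMeasure c) |
      ∃ n ∈ I, f = expL2 c (lam n) ∨ f = expL2 c (-lam n)})ᗮ := by
    rw [Submodule.mem_orthogonal']
    intro u hu
    induction hu using Submodule.span_induction with
    | mem x hx =>
      obtain ⟨n, hn, rfl | rfl⟩ := hx
      · rw [hin, (h n hn).1]
      · rw [hin, (h n hn).2]
    | zero => exact inner_zero_right _
    | add x y _ _ hx hy => rw [inner_add_right, hx, hy, add_zero]
    | smul a x _ hx => rw [inner_smul_right, hx, mul_zero]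
  rw [Submodule.topologicalClosure_eq_top_iff.1 hI, Submodule.mem_bot] at hmem
  have := hs.coeFn_toLp
  rw [hmem] at this
  filter_upwards [this, Lp.coeFn_zero ℂ 2 (symMeasure c)] with v h1 h2
  rw [h2] at h1
  simpa using h1.symm

/-- The Fourier density of `∫ P(y) ((exp (i l y) + exp (-i l y)) / 4 + ∫ w y v exp (i l v))`. -/
noncomputable def density (P : ℝ → ℂ) (w : ℝ → ℝ → ℂ) (v : ℝ) : ℂ :=
  (P v + P (-v)) / 4 + ∫ y, P y * w y v

namespace Potential

variable {d C : ℝ} {P : ℝ → ℂ} {w : ℝ → ℝ → ℂ}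

/-- Only `|v| < y ≤ d` contributes, by the supports of `w` and `P`. This triangularity makes the
vanishing of the density a backward Volterra equation. -/
theorem norm_integral_mul_kernel_le (Q : Potential d P) (K : ConeKernel d C w) (v : ℝ) :
    ‖∫ y, P y * w y v‖ ≤ C * ∫ y in Ioc |v| d, ‖P y‖ := by
  rw [← integral_const_mul, ← integral_indicator measurableSet_Ioc]
  refine norm_integral_le_of_norm_le
    ((integrable_indicator_iff measurableSet_Ioc).2 (Q.integrable.norm.integrableOn.const_mul C))
    (.of_forall fun y => ?_)
  by_cases hy : y ∈ Ioc |v| d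
  · rw [indicator_of_mem hy, norm_mul, mul_comm]
    gcongr
    exact K.bound y hy.2 v
  · rw [indicator_of_notMem hy, norm_mul]
    by_cases hyd : y ≤ d
    · rw [K.support y v (not_lt.1 fun h => hy ⟨h, hyd⟩), norm_zero, mul_zero]
    · rw [Q.eq_zero_of_lt (not_le.1 hyd), norm_zero, zero_mul]

theorem density_eq_zero (Q : Potential d P) (K : ConeKernel d C w) {v : ℝ}
    (hv : v ∉ Icc (-d) d) : density P w v = 0 := by
  have hv' : d < |v| := not_le.1 fun h => hv (abs_le.1 h)
  have h1 : P v = 0 := Q.support v fun h => hv ⟨by linarith [h.1, h.2], h.2⟩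
  have h2 : P (-v) = 0 := Q.support _ fun h => hv ⟨by linarith [h.2], by linarith [h.1, h.2]⟩
  have h3 := Q.norm_integral_mul_kernel_le K v
  rw [Ioc_eq_empty (not_lt.2 hv'.le), setIntegral_empty, mul_zero, norm_le_zero_iff] at h3
  rw [density, h1, h2, h3]
  simp

theorem memLp (Q : Potential d P) : MemLp P 2 volume :=
  (memLp_two_iff_integrable_sq_norm Q.measurable.aestronglyMeasurable).2 Q.integrable_sq

theorem memLp_density (Q : Potential d P) (K : ConeKernel d C w) (c : ℝ) :
    MemLp (density P w) 2 (symMeasure c) := by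
  have h1 : MemLp P 2 (symMeasure c) := Q.memLp.restrict _
  have h2 : MemLp (fun v => P (-v)) 2 (symMeasure c) :=
    (Q.memLp.comp_measurePreserving (Measure.measurePreserving_neg volume)).restrict _
  have hm : Measurable fun z : ℝ × ℝ => P z.2 * w z.2 z.1 :=
    (Q.measurable.comp measurable_snd).mul (K.measurable.comp measurable_swap)
  have h3 : MemLp (fun v => ∫ y, P y * w y v) 2 (symMeasure c) := by
    refine MemLp.of_bound hm.stronglyMeasurable.integral_prod_right'.aestronglyMeasurable
      (C * ∫ y, ‖P y‖) (.of_forall fun v => ?_)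
    refine (Q.norm_integral_mul_kernel_le K v).trans
      (mul_le_mul_of_nonneg_left ?_ K.nonneg)
    exact setIntegral_le_integral Q.integrable.norm (.of_forall fun _ => norm_nonneg _)
  have h4 : density P w = fun v => (1 / 4 : ℂ) * (P v + P (-v)) + ∫ y, P y * w y v := by
    ext v; simp only [density]; ring
  rw [h4]
  exact ((h1.add h2).const_mul _).add h3

/-- Fubini for the kernel term and `v ↦ -v` for the reflected one; restriction to `(-d, d)` loses
nothing because the density vanishes off `[-d, d]`. -/
theorem integral_density_mul_wave (Q : Potential d P) (K : ConeKernel d C w) (l : ℂ) :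
    ∫ v, density P w v * wave l v ∂symMeasure d =
      ∫ y, P y * ((wave l y + wave l (-y)) / 4 + ∫ v, w y v * wave l v) := by
  have hres : ∫ v, density P w v * wave l v ∂symMeasure d = ∫ v, density P w v * wave l v := by
    rw [symMeasure, ← integral_Icc_eq_integral_Ioo]
    refine setIntegral_eq_integral_of_forall_compl_eq_zero fun v hv => ?_
    rw [Q.density_eq_zero K hv, zero_mul]
  obtain ⟨M, hM⟩ := (isCompact_Icc (a := -d) (b := d)).exists_bound_of_continuousOn
    (continuous_wave l).continuousOn
  obtain ⟨N, hN⟩ := K.exists_bound_transform l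
  obtain ⟨C', K'⟩ := K.mul_wave l
  have i1 : Integrable fun v => P v * wave l v :=
    Q.integrable_mul (continuous_wave l).measurable (M := M) fun s hs =>
      hM s ⟨by linarith [hs.1, hs.2], hs.2⟩
  have i2 : Integrable fun v => P v * wave l (-v) :=
    Q.integrable_mul ((continuous_wave l).comp continuous_neg).measurable (M := M) fun s hs =>
      hM (-s) ⟨by linarith [hs.2], by linarith [hs.1, hs.2]⟩
  have i2' : Integrable fun v => P (-v) * wave l v := by simpa using i2.comp_neg
  have e2 : ∫ v, P (-v) * wave l v = ∫ v, P v * wave l (-v) := by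
    have := integral_neg_eq_self (fun v => P v * wave l (-v)) volume
    simpa using this
  have i3 : Integrable fun y => P y * ∫ v, w y v * wave l v :=
    Q.integrable_mul (K.measurable_transform l) fun s hs => hN s hs.2
  have i4 : Integrable (fun ω : ℝ × ℝ => P ω.1 * (w ω.1 ω.2 * wave l ω.2))
      (volume.prod volume) :=
    ((K'.integrable_weight_mul Q.measurable Q.integrable fun _ => Q.eq_zero_of_lt).mul_const
      2).congr (.of_forall fun ω => by simp)
  have i5 : Integrable fun v => (∫ y, P y * w y v) * wave l v := by
    refine i4.integral_prod_right.congr (.of_forall fun v => ?_)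
    simp only [← mul_assoc, integral_mul_const]
  have e5 : ∫ v, (∫ y, P y * w y v) * wave l v = ∫ y, P y * ∫ v, w y v * wave l v := by
    have := integral_integral_swap (f := fun y v => P y * (w y v * wave l v)) i4
    simp only [integral_const_mul] at this
    rw [this]
    refine integral_congr_ae (.of_forall fun v => ?_)
    simp only [← mul_assoc, integral_mul_const]
  have s1 : ∀ v, density P w v * wave l v = (P v * wave l v + P (-v) * wave l v) / 4 +
      (∫ y, P y * w y v) * wave l v := fun v => by rw [density]; ring
  have s2 : ∀ y, P y * ((wave l y + wave l (-y)) / 4 + ∫ v, w y v * wave l v) =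
      (P y * wave l y + P y * wave l (-y)) / 4 + P y * ∫ v, w y v * wave l v := fun y => by ring
  have i12 : Integrable fun v => (P v * wave l v + P (-v) * wave l v) / 4 :=
    (i1.add i2').div_const 4
  have i12' : Integrable fun v => (P v * wave l v + P v * wave l (-v)) / 4 :=
    (i1.add i2).div_const 4
  rw [hres]
  simp only [s1, s2]
  rw [integral_add i12 i5, integral_add i12' i3, e5, integral_div, integral_div,
    integral_add i1 i2', integral_add i1 i2, e2]

/-- The density determines the potential. -/
theorem integral_norm_eq_zero_of_density (Q : Potential d P) (K : ConeKernel d C w) (hd : 0 ≤ d)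
    (h : density P w =ᵐ[symMeasure d] 0) : ∫ v, ‖P v‖ = 0 := by
  have e : ∫ v, ‖P v‖ = ∫ v in Ioc 0 d, ‖P v‖ := by
    refine (setIntegral_eq_integral_of_forall_compl_eq_zero fun v hv => ?_).symm
    rw [Q.support v hv, norm_zero]
  rw [e]
  refine ae_eq_zero_of_norm_le_integral hd (C := 4 * C) (by linarith [K.nonneg]) Q.integrable ?_
  rw [← restrict_Ioo_eq_restrict_Ioc]
  filter_upwards [ae_restrict_of_ae_restrict_of_subset (Ioo_subset_Ioo_left (by linarith)) h,
    ae_restrict_mem measurableSet_Ioo] with v hv hvm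
  have h2 : P (-v) = 0 := Q.support _ fun h => by linarith [h.1, hvm.1]
  have h3 := Q.norm_integral_mul_kernel_le K v
  rw [density, h2, Pi.zero_apply, add_zero] at hv
  have h4 : P v = -(4 * ∫ y, P y * w y v) := by linear_combination 4 * hv
  have : ‖(4 : ℂ)‖ = 4 := by norm_num
  rw [abs_of_pos hvm.1] at h3
  rw [h4, norm_neg, norm_mul, this]
  linarith

/-- The change of variable `y = 2 s`, with Jacobian `1 / 2`, that matches the potential to the
doubled variable of `prodKernel`. -/
theorem comp_half (Q : Potential d P) : Potential (2 * d) fun y => P (y / 2) / 2 where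
  measurable := (Q.measurable.comp (by fun_prop)).div_const 2
  integrable := (Q.integrable.comp_div two_ne_zero).div_const 2
  integrable_sq := ((Q.integrable_sq.comp_div two_ne_zero).div_const 4).congr
    (.of_forall fun s => by simp only [norm_div, Complex.norm_two]; ring)
  support s hs := by
    rw [Q.support, zero_div]
    exact fun h => hs ⟨by linarith [h.1], by linarith [h.2]⟩

theorem sub {P' : ℝ → ℂ} (Q : Potential d P) (Q' : Potential d P') :
    Potential d fun s => P s - P' s where
  measurable := Q.measurable.sub Q'.measurable
  integrable := Q.integrable.sub Q'.integrable
  integrable_sq := (Q.memLp.sub Q'.memLp).integrable_norm_pow two_ne_zero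
  support s hs := by rw [Q.support s hs, Q'.support s hs, sub_zero]

end Potential

end DiscontinuousSL

/-! ### The uniqueness theorem. -/

open DiscontinuousSL

theorem theorem4p1
    (d : ℝ) (hd₀ : 0 < d) (hd : d < 1 / 2)
    (q₁ q₁' q₂ : ℝ → ℝ) (h₁ h₁' h₂ a₁ a₂ : ℝ) (ha₁ : 0 < a₁)
    (hq₁ : MemLp q₁ 2 (volume.restrict (Ioo 0 d)))
    (hq₁' : MemLp q₁' 2 (volume.restrict (Ioo 0 d)))
    (hq₂ : MemLp q₂ 2 (volume.restrict (Ioo 0 (1 - d))))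
    (I : Set ℕ) (lam lam' : ℕ → ℂ)
    (hlam : DiscontinuousSL.IsSpectrum d q₁ q₂ h₁ h₂ a₁ a₂ lam)
    (hlam' : DiscontinuousSL.IsSpectrum d q₁' q₂ h₁' h₂ a₁ a₂ lam')
    (heq : ∀ n ∈ I, lam n = lam' n)
    (homega : DiscontinuousSL.omega d q₁ h₁ = DiscontinuousSL.omega d q₁' h₁')
    (hcomplete : DiscontinuousSL.ExpSystemComplete (2 * d) I lam) :
    q₁ =ᵐ[volume.restrict (Ioo 0 d)] q₁' ∧ h₁ = h₁' := by
  obtain ⟨r, R, hr⟩ := exists_potential hq₁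
  obtain ⟨r', R', hr'⟩ := exists_potential hq₁'
  rw [restrict_Ioo_eq_restrict_Ioc] at hq₁ hq₁' hq₂ ⊢
  have D := R'.sub R
  -- Equality of `ω₁` and `ω̃₁`, in the form that cancels the part of the eigenvalue identity not
  -- expressible through the density.
  have hom : ((h₁' : ℂ) - h₁) + (∫ s, ((r' s : ℂ) - r s)) / 2 = 0 := by
    have e : ∫ s, ((r' s : ℂ) - r s) = ((∫ s in (0 : ℝ)..d, q₁' s : ℝ) : ℂ) -
        ((∫ s in (0 : ℝ)..d, q₁ s : ℝ) : ℂ) := by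
      rw [integral_sub R'.integrable R.integrable,
        ← setIntegral_eq_integral_of_forall_compl_eq_zero R'.support,
        ← setIntegral_eq_integral_of_forall_compl_eq_zero R.support,
        integral_complex_ofReal, integral_complex_ofReal, ← integral_congr_ae hr',
        ← integral_congr_ae hr, intervalIntegral.integral_of_le hd₀.le,
        intervalIntegral.integral_of_le hd₀.le]
    have h := congrArg (Complex.ofReal) homega
    simp only [omega] at h
    push_cast at h
    rw [e]
    linear_combination -h
  obtain ⟨C, K⟩ := R.exists_coneKernel hd₀.le h₁
  obtain ⟨C', K'⟩ := R'.exists_coneKernel hd₀.le h₁'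
  have W := K.prod K' hd₀.le
  have zero_transform : ∀ l : ℂ, IsEigenvalue d q₁ q₂ h₁ h₂ a₁ a₂ (l ^ 2) →
      IsEigenvalue d q₁' q₂ h₁' h₂ a₁ a₂ (l ^ 2) →
      ∫ v, density (fun y => ((r' (y / 2) : ℂ) - r (y / 2)) / 2)
        (prodKernel (kernel (fun s => (r s : ℂ)) h₁) (kernel (fun s => (r' s : ℂ)) h₁')) v *
          wave l v ∂symMeasure (2 * d) = 0 := by
    intro l E E'
    have id := common_eigenvalue_identity hd₀ (by linarith) hq₂ hq₁ hq₁' hr hr' R R' ha₁ E E'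
    rw [D.comp_half.integral_density_mul_wave W l]
    set w := prodKernel (kernel (fun s => (r s : ℂ)) h₁) (kernel (fun s => (r' s : ℂ)) h₁')
    set T : ℝ → ℂ := fun y => (wave l y + wave l (-y)) / 4 + ∫ v, w y v * wave l v with hT
    have e1 : ∫ y, ((r' (y / 2) : ℂ) - r (y / 2)) / 2 * T y =
        ∫ s, ((r' s : ℂ) - r s) * T (2 * s) := by
      have := Measure.integral_comp_div (fun s => ((r' s : ℂ) - r s) * T (2 * s)) 2
      have h2 : ∀ y : ℝ, 2 * (y / 2) = y := fun y => by ring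
      simp only [h2] at this
      have h3 : ∀ y, ((r' (y / 2) : ℂ) - r (y / 2)) / 2 * T y =
          ((r' (y / 2) : ℂ) - r (y / 2)) * T y / 2 := fun y => by ring
      simp only [h3]
      rw [integral_div, this]
      simp
    obtain ⟨N, hN⟩ := W.exists_bound_transform l
    obtain ⟨M, hM⟩ := (isCompact_Icc (a := -(2 * d)) (b := 2 * d)).exists_bound_of_continuousOn
      (continuous_wave l).continuousOn
    have mT : Measurable T := (((continuous_wave l).measurable.add
      ((continuous_wave l).comp continuous_neg).measurable).div_const 4).add
        (W.measurable_transform l)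
    have iT : Integrable fun s => ((r' s : ℂ) - r s) * T (2 * s) := by
      refine D.integrable_mul (mT.comp (by fun_prop)) (M := (M + M) / 4 + N) fun s hs => ?_
      have m0 : 2 * s ≤ 2 * d := by linarith [hs.2]
      refine (norm_add_le _ _).trans (add_le_add ?_ (hN _ m0))
      rw [norm_div]
      have : ‖(4 : ℂ)‖ = 4 := by norm_num
      rw [this]
      have m1 : 2 * s ∈ Icc (-(2 * d)) (2 * d) :=
        ⟨by linarith [hs.1, hs.2], by linarith [hs.2]⟩
      have m2 : -(2 * s) ∈ Icc (-(2 * d)) (2 * d) :=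
        ⟨by linarith [hs.2], by linarith [hs.1, hs.2]⟩
      have := (norm_add_le (wave l (2 * s)) (wave l (-(2 * s)))).trans
        (add_le_add (hM _ m1) (hM _ m2))
      linarith
    have e2 : ∫ s in (0 : ℝ)..d, ((r' s : ℂ) - r s) *
        (phi (fun s => (r s : ℂ)) h₁ l s * phi (fun s => (r' s : ℂ)) h₁' l s) =
        (∫ s, ((r' s : ℂ) - r s)) / 2 + ∫ s, ((r' s : ℂ) - r s) * T (2 * s) := by
      rw [← integral_div, ← integral_add (D.integrable.div_const 2) iT,
        intervalIntegral.integral_of_le hd₀.le]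
      refine Eq.trans ?_
        (setIntegral_eq_integral_of_forall_compl_eq_zero (s := Ioc 0 d) fun s hs => ?_)
      · refine setIntegral_congr_fun measurableSet_Ioc fun s hs => ?_
        simp only [phi, hT]
        rw [K.transform_prodKernel K' l hs.2]
        ring
      · rw [D.support s hs]
        simp
    rw [e1]
    rw [e2] at id
    linear_combination id - hom
  obtain ⟨E, -, hE, hEr⟩ := hlam
  obtain ⟨E', -, hE', hEr'⟩ := hlam'
  have eig : ∀ n ∈ I, IsEigenvalue d q₁ q₂ h₁ h₂ a₁ a₂ (lam n ^ 2) ∧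
      IsEigenvalue d q₁' q₂ h₁' h₂ a₁ a₂ (lam n ^ 2) := by
    intro n hn
    constructor
    · have : lam n ^ 2 ∈ {z : ℂ | IsEigenvalue d q₁ q₂ h₁ h₂ a₁ a₂ z} := by
        rw [hEr, hE]; exact ⟨n, rfl⟩
      exact this
    · have : lam n ^ 2 ∈ {z : ℂ | IsEigenvalue d q₁' q₂ h₁' h₂ a₁ a₂ z} := by
        rw [hEr', heq n hn, hE']; exact ⟨n, rfl⟩
      exact this
  -- Both signs of `lam n` are covered, since only the square enters the eigenvalue problem.
  have dens := ae_eq_zero_of_complete hcomplete (D.comp_half.memLp_density W _) fun n hn =>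
    ⟨zero_transform _ (eig n hn).1 (eig n hn).2, zero_transform _
      (by rw [neg_sq]; exact (eig n hn).1) (by rw [neg_sq]; exact (eig n hn).2)⟩
  have hz := D.comp_half.integral_norm_eq_zero_of_density W (by linarith) dens
  have hz' : ∫ s, ‖(r' s : ℂ) - r s‖ = 0 := by
    have := Measure.integral_comp_div (fun s => ‖(r' s : ℂ) - r s‖) 2
    simp only [norm_div, Complex.norm_two, integral_div] at hz
    rw [this] at hz
    simpa using hz
  have hae : ∀ᵐ s, (r' s : ℂ) - r s = 0 := by
    filter_upwards [(integral_eq_zero_iff_of_nonneg (fun _ => norm_nonneg _)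
      D.integrable.norm).1 hz'] with s hs
    exact norm_eq_zero.1 hs
  refine ⟨?_, ?_⟩
  · filter_upwards [hr, hr', ae_restrict_of_ae hae] with s h1 h2 h3
    rw [h1, h2]
    exact_mod_cast (sub_eq_zero.1 h3).symm
  · rw [integral_eq_zero_of_ae hae, zero_div, add_zero] at hom
    exact_mod_cast (sub_eq_zero.1 hom).symm
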